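/- Let $(\zeta_i)_{i\ge 0}$ be i.i.d. random vectors with values in $\mathbb Z^2$ on a probability space $(\Omega,\mathbb P)$, with mean $0$, finite variance and nonsingular covariance matrix $\Sigma$, and aperiodic: the subgroup generated by $\{\ell\in\mathbb Z^2:\mathbb P(\zeta_0=\ell)>0\}$ is $\mathbb Z^2$. Let $Z_0=0$ and $Z_n=\zeta_0+\dots+\zeta_{n-1}$ for $n\ge 1$. For finite sets $I,J\subset\mathbb N$ and $p\in\mathbb Z^2$ put $$V(\omega,I,J,p)=\#\{(u,v)\in I\times J:\ Z_u(\omega)-Z_v(\omega)=p\},\qquad V(\omega,I,p)=V(\omega,I,I,p),$$ and put $$C_0=\frac1{\pi\sqrt{\det\Sigma}},\qquad \varphi_m(\omega,p)=\frac{V(\omega,[1,m],p)}{C_0\,m\ln m}.$$ Let $\theta$ be the shift on step sequences, so that $\varphi_m(\theta^k\omega,p)$ is computed as $\varphi_m(\omega,p)$ with $(\zeta_{i+k})_{i\ge0}$ in place of $(\zeta_i)_{i\ge0}$. Intervals are intervals of integers. Then there is a set $\hat\Omega\subset\Omega$ with $\mathbb P(\hat\Omega)=1$ such that, for all $\omega\in\hat\Omega$,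 all $p\in\mathbb Z^2$ and all $A\in(0,1)$, with $B=1-A$, the following holds whenever, for every $n$, the integers $a_n,a_n'$ belong to $\{\lfloor nA\rfloor,\lfloor nA\rfloor+1\}$ and $b_n$ belongs to $\{\lfloor nB\rfloor,\lfloor nB\rfloor+1\}$: $$\lim_{n\to\infty}\varphi_{b_n}(\theta^{a_n}\omega,p)=\lim_{n\to\infty}\frac{V(\omega,[a_n,n],p)}{C_0\,n(1-A)\ln n}=1,$$ $$V(\omega,[1,a_n],[a_n',n],p)+V(\omega,[a_n',n],[1,a_n],p)=o(n\ln n)\quad\text{as } n\to\infty .$$ -/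

import Mathlib

open MeasureTheory ProbabilityTheory Filter Topology Asymptotics

noncomputable section

/-- The position `Z_n = ζ_0 + ... + ζ_{n-1}` of the walk on `ℤ²` with step sequence `ζ = s`,
starting from `Z_0 = 0`. -/
def walk (s : ℕ → (Fin 2 → ℤ)) (n : ℕ) : Fin 2 → ℤ := ∑ i ∈ Finset.range n, s i

/-- The iterate `θ^k` of the shift on step sequences. -/
def shift (k : ℕ) (s : ℕ → (Fin 2 → ℤ)) : ℕ → (Fin 2 → ℤ) := fun i => s (i + k)

/-- `V(ω, I, J, p) = #{(u, v) ∈ I × J : Z_u(ω) - Z_v(ω) = p}`, for the trajectory with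
step sequence `s`. -/
def crossCount (s : ℕ → (Fin 2 → ℤ)) (I J : Finset ℕ) (p : Fin 2 → ℤ) : ℕ :=
  ((I ×ˢ J).filter (fun uv => walk s uv.1 - walk s uv.2 = p)).card

/-- `V(ω, I, p) = V(ω, I, I, p)`. -/
def selfCount (s : ℕ → (Fin 2 → ℤ)) (I : Finset ℕ) (p : Fin 2 → ℤ) : ℕ := crossCount s I I p

/-- `φ_m(ω, p) = V(ω, [1, m], p) / (C m ln m)`. -/
def normalizedCount (C : ℝ) (s : ℕ → (Fin 2 → ℤ)) (m : ℕ) (p : Fin 2 → ℤ) : ℝ :=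
  (selfCount s (Finset.Icc 1 m) p : ℝ) / (C * m * Real.log m)

/-- The covariance matrix of a random vector with values in `ℤ²`. -/
def covMatrix {Ω : Type*} [MeasurableSpace Ω] (P : Measure Ω) (X : Ω → (Fin 2 → ℤ)) :
    Matrix (Fin 2) (Fin 2) ℝ :=
  Matrix.of fun i j => covariance (fun ω => (X ω i : ℝ)) (fun ω => (X ω j : ℝ)) P

/-- The constant `C₀ = (π √(det Σ))⁻¹`, where `Σ` is the covariance matrix of a step. -/
def walkConst {Ω : Type*} [MeasurableSpace Ω] (P : Measure Ω) (X : Ω → (Fin 2 → ℤ)) : ℝ :=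
  (Real.pi * Real.sqrt (covMatrix P X).det)⁻¹

/-- `(ζ_i)` are the steps of an aperiodic centered random walk on `ℤ²` with finite variance and
nonsingular covariance matrix. -/
structure IsPlanarWalkSteps {Ω : Type*} [MeasurableSpace Ω] (P : Measure Ω)
    (ζ : ℕ → Ω → (Fin 2 → ℤ)) : Prop where
  measurable : ∀ i, Measurable (ζ i)
  indep : iIndepFun ζ P
  identDistrib : ∀ i, IdentDistrib (ζ i) (ζ 0) P P
  memLp_two : ∀ j, MemLp (fun ω => (ζ 0 ω j : ℝ)) 2 P
  mean_zero : ∀ j, ∫ ω, (ζ 0 ω j : ℝ) ∂P = 0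
  cov_nonsingular : (covMatrix P (ζ 0)).det ≠ 0
  /-- The subgroup generated by the possible values of a step is `ℤ²`. -/
  aperiodic : AddSubgroup.closure {l : Fin 2 → ℤ | 0 < P (ζ 0 ⁻¹' {l})} = ⊤

/-- `a n` is one of the two integers `⌊n x⌋`, `⌊n x⌋ + 1`, for every `n`. -/
def IsRounding (x : ℝ) (a : ℕ → ℕ) : Prop :=
  ∀ n : ℕ, a n = ⌊(n : ℝ) * x⌋₊ ∨ a n = ⌊(n : ℝ) * x⌋₊ + 1

end

/-! The counts on time intervals are nondecreasing in the interval, so everything reduces to one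
almost sure statement along dyadic intervals: for each `p` and all integers `i ≤ j`, the self-count
on `(i 2^k, j 2^k]` is asymptotic to `C₀ (j - i) 2^k · k log 2` when `i < j`
(`ae_tendsto_dyadic_selfCount`). Only countably many triples `(p, i, j)` occur, so one null set
serves every `A` and every rounding. From there the argument is pathwise: `tendsto_of_dyadic`
squeezes a proportional interval between unions of dyadic cells, and `counts_of_dyadic` obtains the
cross counts by subtraction, since the self-counts of the two pieces already exhaust the leading
term: `C₀ - C₀ A - C₀ (1 - A) = 0`.

The dyadic law is a mean asymptotic plus a variance bound. An interval of length `2N` splits into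
two halves with independent self-counts plus cross counts, whose second moment is `O(N²)`
(`integral_sq_crossCount_le`). Iterating gives variance `O(4^k)` at scale `2^k`
(`exists_variance_selfCount_le`). After division by `(2^k k)²` this is `O(1/k²)`, which is summable.
The second moment rests on the bound `P(Z_n = x) ≤ K/(n+1)`, uniform in `x` (`exists_atom_bound`).

For the mean, aperiodicity only means that the steps generate `ℤ²`; the walk may still be periodic
in time, like simple random walk, and `P(Z_n = p)` need not be asymptotic to `c/n`. The Abel sums `∑
r^k P(Z_k = p)` do not feel this: they are Fourier integrals of `1/(1 - rφ)`, singular as `r → 1`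
only where the characteristic function `φ` equals `1`, that is, at the origin. There `1 - rφ` is
close to `s + q/2`, with `s = 1 - r` and `q` the covariance form, and integration over a small
ellipse yields the logarithm with its constant (`tendsto_abel_div_log`). Since `k P(Z_k = p)` is
bounded, Abel sums and averaged partial sums differ by `O(1)`, so no Tauberian theorem is needed
(`abs_sum_partialSums_sub_abel_le`). Similarly, the atom bound uses `φ` only near `0`, through the
averaging inequality `measureReal_atom_le`. -/

/-! ### Interpolation from dyadic intervals to intervals of proportional length. -/

lemma tendsto_log_two_sub_div_log (m : ℕ) :
    Tendsto (fun n : ℕ => ((Nat.log 2 n - m : ℕ) : ℝ) / Real.log n) atTop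
      (𝓝 (1 / Real.log 2)) := by
  have h2 : 0 < Real.log 2 := Real.log_pos (by norm_num)
  have hlog : Tendsto (fun n : ℕ => Real.log n) atTop atTop :=
    Real.tendsto_log_atTop.comp tendsto_natCast_atTop_atTop
  have hlow : Tendsto (fun n : ℕ => 1 / Real.log 2 - (m + 1 : ℝ) / Real.log n) atTop
      (𝓝 (1 / Real.log 2 - 0)) :=
    tendsto_const_nhds.sub (hlog.const_div_atTop _)
  rw [sub_zero] at hlow
  refine tendsto_of_tendsto_of_tendsto_of_le_of_le' hlow tendsto_const_nhds ?_ ?_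
  · filter_upwards [hlog.eventually_gt_atTop 0, eventually_ge_atTop 1] with n hn h1
    have hn1 : n < 2 ^ (Nat.log 2 n + 1) := Nat.lt_pow_succ_log_self (by norm_num) n
    have hlt : Real.log n ≤ (Nat.log 2 n + 1 : ℕ) * Real.log 2 := by
      rw [← Real.log_pow]
      exact Real.log_le_log (by exact_mod_cast h1) (by exact_mod_cast hn1.le)
    have hk : (Nat.log 2 n : ℝ) ≤ ((Nat.log 2 n - m : ℕ) : ℝ) + m := by
      exact_mod_cast (by omega : Nat.log 2 n ≤ Nat.log 2 n - m + m)
    rw [div_sub_div _ _ h2.ne' hn.ne', div_le_div_iff₀ (by positivity) hn]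
    push_cast at hlt
    have : Real.log n ≤ (((Nat.log 2 n - m : ℕ) : ℝ) + m + 1) * Real.log 2 :=
      hlt.trans (by gcongr)
    nlinarith
  · filter_upwards [hlog.eventually_gt_atTop 0, eventually_ge_atTop 1] with n hn h1
    have hn1 : 2 ^ (Nat.log 2 n) ≤ n := Nat.pow_log_le_self 2 (by omega)
    have hle : (Nat.log 2 n : ℝ) * Real.log 2 ≤ Real.log n := by
      rw [← Real.log_pow]
      exact Real.log_le_log (by positivity) (by exact_mod_cast hn1)
    have hk : ((Nat.log 2 n - m : ℕ) : ℝ) ≤ Nat.log 2 n := by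
      exact_mod_cast Nat.sub_le _ _
    rw [div_le_div_iff₀ hn h2]
    nlinarith

lemma tendsto_log_two_sub_atTop (m : ℕ) :
    Tendsto (fun n : ℕ => Nat.log 2 n - m) atTop atTop := by
  refine tendsto_atTop.2 fun b => ?_
  filter_upwards [eventually_ge_atTop (2 ^ (b + m))] with n hn
  have := Nat.log_mono_right (b := 2) hn
  rw [Nat.log_pow (by norm_num)] at this
  omega

set_option maxHeartbeats 800000 in
/-- An interval function that is monotone and has the growth `C (j - i) N log N` along the dyadic
intervals `(i 2^k, j 2^k]` has this growth along all intervals of proportional length. -/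
lemma tendsto_of_dyadic {W : ℕ → ℕ → ℝ} {C : ℝ} (hC : 0 ≤ C)
    (hmono : ∀ {l l' r r' : ℕ}, l' ≤ l → r ≤ r' → W l r ≤ W l' r') (hpos : ∀ l r, 0 ≤ W l r)
    (hlim : ∀ i j : ℕ, i ≤ j →
      Tendsto (fun k : ℕ => W (i * 2 ^ k) (j * 2 ^ k) / (2 ^ k * k)) atTop
        (𝓝 (C * (j - i) * Real.log 2)))
    {l r : ℕ → ℕ} {α β : ℝ} (hl : Tendsto (fun n : ℕ => (l n : ℝ) / n) atTop (𝓝 α))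
    (hr : Tendsto (fun n : ℕ => (r n : ℝ) / n) atTop (𝓝 β)) (hαβ : α < β) :
    Tendsto (fun n : ℕ => W (l n) (r n) / (n * Real.log n)) atTop (𝓝 (C * (β - α))) := by
  have h2 : 0 < Real.log 2 := Real.log_pos (by norm_num)
  have hlog : Tendsto (fun n : ℕ => Real.log n) atTop atTop :=
    Real.tendsto_log_atTop.comp tendsto_natCast_atTop_atTop
  -- An absolute error of `1` suffices: the mesh will be at most `n / 2^m`, so relative to `n` this
  -- error is at most `2^{-m}`, and `m` is sent to infinity last.
  have hunif : ∀ M : ℕ, ∀ᶠ k : ℕ in atTop, ∀ i ≤ M, ∀ j ≤ M, i ≤ j →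
      (C * (j - i) * Real.log 2 - 1) * (2 ^ k * k) ≤ W (i * 2 ^ k) (j * 2 ^ k) ∧
      W (i * 2 ^ k) (j * 2 ^ k) ≤ (C * (j - i) * Real.log 2 + 1) * (2 ^ k * k) := by
    intro M
    have : ∀ i ∈ Set.Iic M, ∀ᶠ k : ℕ in atTop, ∀ j ∈ Set.Iic M, i ≤ j →
      (C * (j - i) * Real.log 2 - 1) * (2 ^ k * k) ≤ W (i * 2 ^ k) (j * 2 ^ k) ∧
      W (i * 2 ^ k) (j * 2 ^ k) ≤ (C * (j - i) * Real.log 2 + 1) * (2 ^ k * k) := by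
      intro i _
      refine (eventually_all_finite (Set.finite_Iic M)).2 fun j _ => ?_
      by_cases hij : i ≤ j
      · filter_upwards [(hlim i j hij).eventually (lt_mem_nhds (sub_one_lt _)),
          (hlim i j hij).eventually (gt_mem_nhds (lt_add_one _)), eventually_gt_atTop 0]
          with k hk1 hk2 hk0 _
        have : (0 : ℝ) < 2 ^ k * k := by positivity
        exact ⟨((lt_div_iff₀ this).1 hk1).le, ((div_lt_iff₀ this).1 hk2).le⟩
      · exact Eventually.of_forall fun k h => absurd h hij
    exact (eventually_all_finite (Set.finite_Iic M)).2 this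
  have key : ∀ m : ℕ, ∀ᶠ n : ℕ in atTop,
      (C * ((r n : ℝ) / n - l n / n - 2 / 2 ^ m) * Real.log 2 - 1 / 2 ^ m) *
          (((Nat.log 2 n - m : ℕ) : ℝ) / Real.log n) ≤ W (l n) (r n) / (n * Real.log n) ∧
      W (l n) (r n) / (n * Real.log n) ≤
        (C * ((r n : ℝ) / n - l n / n + 2 / 2 ^ m) * Real.log 2 + 1 / 2 ^ m) *
          (((Nat.log 2 n - m : ℕ) : ℝ) / Real.log n) := by
    intro m
    -- Eventually `r n ≤ (β + 1) n` and `n < 2^k 2^{m+1}`, so the cell indices stay below a bound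
    -- independent of `n`; the final `+ 1` leaves room for the outer endpoint.
    obtain ⟨M, hM⟩ := exists_nat_gt ((β + 1) * 2 ^ (m + 1) + 1)
    filter_upwards [(tendsto_log_two_sub_atTop m).eventually (hunif M),
      hr.eventually (gt_mem_nhds (lt_add_one β)),
      (hl.sub hr).eventually (gt_mem_nhds (sub_neg.2 hαβ)),
      hlog.eventually_gt_atTop 0, eventually_ge_atTop (2 ^ m)] with n hW hrn hlr hlogn hn
    have hn0 : 0 < n := lt_of_lt_of_le (by positivity) hn
    have hn0' : (0 : ℝ) < n := by exact_mod_cast hn0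
    have hmle : m ≤ Nat.log 2 n := by
      have := Nat.log_mono_right (b := 2) hn
      rwa [Nat.log_pow (by norm_num)] at this
    -- The mesh `2^k` lies between `n / 2^{m+1}` and `n / 2^m`; rounding both endpoints to it costs
    -- at most two cells.
    set k := Nat.log 2 n - m with hk
    have hkm : Nat.log 2 n = k + m := by omega
    have hn1 : n < 2 ^ k * 2 ^ (m + 1) := by
      rw [← pow_add, ← add_assoc, ← hkm]; exact Nat.lt_pow_succ_log_self (by norm_num) n
    have hn2 : 2 ^ k * 2 ^ m ≤ n := by
      rw [← pow_add, ← hkm]; exact Nat.pow_log_le_self 2 (by omega)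
    have hk0 : 0 < 2 ^ k := by positivity
    rw [← sub_div, div_lt_iff₀ hn0', zero_mul, sub_neg, Nat.cast_lt] at hlr
    have hx : (2 : ℝ) ^ k ≤ n / 2 ^ m := by
      rw [le_div_iff₀ (by positivity)]; exact_mod_cast hn2
    have hjM : r n / 2 ^ k + 1 ≤ M := by
      have h1 : ((r n / 2 ^ k : ℕ) : ℝ) ≤ r n / 2 ^ k := by
        exact_mod_cast Nat.cast_div_le (α := ℝ) (m := r n) (n := 2 ^ k)
      have h2 : (r n : ℝ) / 2 ^ k ≤ (β + 1) * 2 ^ (m + 1) := by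
        rw [div_le_iff₀ (by positivity)]
        rw [div_lt_iff₀ hn0'] at hrn
        have hb : 0 ≤ β + 1 := by
          by_contra hb
          push Not at hb
          nlinarith [(Nat.cast_nonneg (r n) : (0 : ℝ) ≤ r n)]
        have : (n : ℝ) ≤ 2 ^ k * 2 ^ (m + 1) := by exact_mod_cast hn1.le
        nlinarith
      have : ((r n / 2 ^ k + 1 : ℕ) : ℝ) ≤ M := by push_cast; linarith
      exact_mod_cast this
    have hdl := Nat.div_add_mod (l n) (2 ^ k)
    have hdr := Nat.div_add_mod (r n) (2 ^ k)
    have hml := Nat.mod_lt (l n) hk0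
    have hmr := Nat.mod_lt (r n) hk0
    have hij : l n / 2 ^ k ≤ r n / 2 ^ k := Nat.div_le_div_right hlr.le
    have e1 : ∀ c : ℝ, c * ((k : ℝ) / Real.log n) = (c * n * k) / (n * Real.log n) := by
      intro c; field_simp
    have hcast_l : (l n : ℝ) = 2 ^ k * (l n / 2 ^ k : ℕ) + (l n % 2 ^ k : ℕ) := by
      exact_mod_cast hdl.symm
    have hcast_r : (r n : ℝ) = 2 ^ k * (r n / 2 ^ k : ℕ) + (r n % 2 ^ k : ℕ) := by
      exact_mod_cast hdr.symm
    have hml' : ((l n % 2 ^ k : ℕ) : ℝ) ≤ 2 ^ k := by exact_mod_cast hml.le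
    have hmr' : ((r n % 2 ^ k : ℕ) : ℝ) ≤ 2 ^ k := by exact_mod_cast hmr.le
    have hml0 : (0 : ℝ) ≤ ((l n % 2 ^ k : ℕ) : ℝ) := Nat.cast_nonneg _
    have hmr0 : (0 : ℝ) ≤ ((r n % 2 ^ k : ℕ) : ℝ) := Nat.cast_nonneg _
    have hkk : (0 : ℝ) ≤ k := Nat.cast_nonneg _
    have hCl : 0 ≤ C * Real.log 2 := by positivity
    rw [e1, e1]
    constructor
    · gcongr
      have hb : (C * ((r n : ℝ) / n - l n / n - 2 / 2 ^ m) * Real.log 2 - 1 / 2 ^ m) * n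
          ≤ C * Real.log 2 * (r n - l n - 2 * 2 ^ k) - 2 ^ k := by
        have : (C * ((r n : ℝ) / n - l n / n - 2 / 2 ^ m) * Real.log 2 - 1 / 2 ^ m) * n
          = C * Real.log 2 * (r n - l n - 2 * (n / 2 ^ m)) - n / 2 ^ m := by
          field_simp
        rw [this]; gcongr
      refine (mul_le_mul_of_nonneg_right hb hkk).trans ?_
      by_cases hij' : l n / 2 ^ k + 1 ≤ r n / 2 ^ k
      · refine le_trans ?_ ((hW _ (hij'.trans ((Nat.le_succ _).trans hjM)) _
          ((Nat.le_succ _).trans hjM) hij').1.trans (hmono ?_ ?_))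
        · rw [← mul_assoc]
          gcongr
          push_cast
          rw [hcast_l, hcast_r]
          have := mul_nonneg hCl (add_nonneg (sub_nonneg.2 hmr') hml0)
          linarith
        · rw [add_mul, one_mul, mul_comm]; omega
        · exact Nat.div_mul_le_self _ _
      -- No dyadic cell is known to fit inside; the interval is then shorter than two cells and the
      -- claimed lower bound is not positive.
      · refine le_trans (mul_nonpos_of_nonpos_of_nonneg ?_ hkk) (hpos _ _)
        have : r n / 2 ^ k ≤ l n / 2 ^ k := by omega
        have : ((r n / 2 ^ k : ℕ) : ℝ) ≤ (l n / 2 ^ k : ℕ) := by exact_mod_cast this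
        have h3 : (r n : ℝ) - l n - 2 * 2 ^ k ≤ 0 := by
          rw [hcast_l, hcast_r]
          have := mul_le_mul_of_nonneg_left this (by positivity : (0 : ℝ) ≤ 2 ^ k)
          have : (0 : ℝ) < 2 ^ k := by positivity
          linarith
        have := mul_nonpos_of_nonneg_of_nonpos hCl h3
        have : (0 : ℝ) < 2 ^ k := by positivity
        linarith
    · gcongr
      have hb : C * Real.log 2 * (r n - l n + 2 * 2 ^ k) + 2 ^ k ≤
          (C * ((r n : ℝ) / n - l n / n + 2 / 2 ^ m) * Real.log 2 + 1 / 2 ^ m) * n := by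
        have : (C * ((r n : ℝ) / n - l n / n + 2 / 2 ^ m) * Real.log 2 + 1 / 2 ^ m) * n
          = C * Real.log 2 * (r n - l n + 2 * (n / 2 ^ m)) + n / 2 ^ m := by
          field_simp
        rw [this]; gcongr
      refine le_trans ?_ (mul_le_mul_of_nonneg_right hb hkk)
      refine le_trans (hmono ?_ ?_) ((hW (l n / 2 ^ k) (hij.trans ((Nat.le_succ _).trans hjM))
        (r n / 2 ^ k + 1) hjM (hij.trans (Nat.le_succ _))).2.trans ?_)
      · exact Nat.div_mul_le_self _ _
      · rw [add_mul, one_mul, mul_comm]; omega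
      · rw [← mul_assoc]
        gcongr
        push_cast
        rw [hcast_l, hcast_r]
        have := mul_nonneg hCl (add_nonneg (sub_nonneg.2 hml') hmr0)
        linarith
  have hlims : ∀ (m : ℕ) (c d : ℝ), Tendsto (fun n : ℕ =>
      (C * ((r n : ℝ) / n - l n / n + c) * Real.log 2 + d) *
          (((Nat.log 2 n - m : ℕ) : ℝ) / Real.log n)) atTop
          (𝓝 ((C * (β - α + c) * Real.log 2 + d) * (1 / Real.log 2))) := fun m c d =>
    (((((hr.sub hl).add_const c).const_mul C).mul_const _).add_const d).mul
      (tendsto_log_two_sub_div_log m)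
  have hsmall : Tendsto (fun m : ℕ => (2 * C + 1 / Real.log 2) * (1 / 2 : ℝ) ^ m) atTop (𝓝 0) := by
    simpa using (tendsto_pow_atTop_nhds_zero_of_lt_one (r := (1 / 2 : ℝ)) (by norm_num)
      (by norm_num)).const_mul (2 * C + 1 / Real.log 2)
  refine tendsto_order.2 ⟨fun x hx => ?_, fun x hx => ?_⟩
  · obtain ⟨m, hm⟩ := (hsmall.eventually (gt_mem_nhds (sub_pos.2 hx))).exists
    have h1 := (hlims m (-(2 / 2 ^ m)) (-(1 / 2 ^ m))).eventually (lt_mem_nhds (show x < _ by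
      have : (C * (β - α + -(2 / 2 ^ m)) * Real.log 2 + -(1 / 2 ^ m)) * (1 / Real.log 2) =
        C * (β - α) - (2 * C + 1 / Real.log 2) * (1 / 2 : ℝ) ^ m := by
        rw [div_pow, one_pow]; field_simp; ring
      rw [this]; linarith))
    filter_upwards [h1, key m] with n h1 h2
    rw [← sub_eq_add_neg, ← sub_eq_add_neg] at h1
    exact h1.trans_le h2.1
  · obtain ⟨m, hm⟩ := (hsmall.eventually (gt_mem_nhds (sub_pos.2 hx))).exists
    have h1 := (hlims m (2 / 2 ^ m) (1 / 2 ^ m)).eventually (gt_mem_nhds (show _ < x by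
      have : (C * (β - α + 2 / 2 ^ m) * Real.log 2 + 1 / 2 ^ m) * (1 / Real.log 2) =
        C * (β - α) + (2 * C + 1 / Real.log 2) * (1 / 2 : ℝ) ^ m := by
        rw [div_pow, one_pow]; field_simp; ring
      rw [this]; linarith))
    filter_upwards [h1, key m] with n h1 h2
    exact h2.2.trans_lt h1

/-! ### Algebra of the counts, and the pathwise deduction of the three limits. -/

lemma crossCount_mono (s : ℕ → (Fin 2 → ℤ)) {I I' J J' : Finset ℕ} (hI : I ⊆ I') (hJ : J ⊆ J')
    (p : Fin 2 → ℤ) : crossCount s I J p ≤ crossCount s I' J' p :=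
  Finset.card_le_card (Finset.filter_subset_filter _ (Finset.product_subset_product hI hJ))

lemma crossCount_le (s : ℕ → (Fin 2 → ℤ)) (I J : Finset ℕ) (p : Fin 2 → ℤ) :
    crossCount s I J p ≤ I.card * J.card :=
  (Finset.card_filter_le _ _).trans (Finset.card_product _ _).le

lemma crossCount_eq_sum (s : ℕ → (Fin 2 → ℤ)) (I J : Finset ℕ) (p : Fin 2 → ℤ) :
    crossCount s I J p = ∑ u ∈ I, ∑ v ∈ J, if walk s u - walk s v = p then 1 else 0 := by
  rw [crossCount, Finset.card_filter, Finset.sum_product]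

lemma crossCount_union_left (s : ℕ → (Fin 2 → ℤ)) {I I' : Finset ℕ} (h : Disjoint I I')
    (J : Finset ℕ) (p : Fin 2 → ℤ) :
    crossCount s (I ∪ I') J p = crossCount s I J p + crossCount s I' J p := by
  simp only [crossCount_eq_sum, Finset.sum_union h]

lemma crossCount_union_right (s : ℕ → (Fin 2 → ℤ)) (I : Finset ℕ) {J J' : Finset ℕ}
    (h : Disjoint J J') (p : Fin 2 → ℤ) :
    crossCount s I (J ∪ J') p = crossCount s I J p + crossCount s I J' p := by
  simp only [crossCount_eq_sum, Finset.sum_union h, Finset.sum_add_distrib]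

lemma selfCount_union (s : ℕ → (Fin 2 → ℤ)) {I J : Finset ℕ} (h : Disjoint I J)
    (p : Fin 2 → ℤ) :
    selfCount s (I ∪ J) p =
      selfCount s I p + selfCount s J p + (crossCount s I J p + crossCount s J I p) := by
  simp only [selfCount, crossCount_union_left s h, crossCount_union_right s _ h]
  ring

lemma crossCount_swap (s : ℕ → (Fin 2 → ℤ)) (I J : Finset ℕ) (p : Fin 2 → ℤ) :
    crossCount s J I p = crossCount s I J (-p) := by
  rw [crossCount_eq_sum, crossCount_eq_sum, Finset.sum_comm]
  refine Finset.sum_congr rfl fun u _ => Finset.sum_congr rfl fun v _ => ?_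
  simp only [← neg_sub (walk s u) (walk s v), neg_eq_iff_eq_neg]

lemma walk_shift (s : ℕ → (Fin 2 → ℤ)) (a u : ℕ) :
    walk (shift a s) u = walk s (a + u) - walk s a := by
  simp only [walk, shift]
  rw [Finset.sum_range_add, add_sub_cancel_left]
  exact Finset.sum_congr rfl fun i _ => by rw [add_comm]

/-- Shifting moves the origin of the walk to `Z_a`, which cancels in differences. Half-open
intervals are used from here on because adjacent ones concatenate without overlap. -/
lemma selfCount_shift (s : ℕ → (Fin 2 → ℤ)) (a b : ℕ) (p : Fin 2 → ℤ) :
    selfCount (shift a s) (Finset.Icc 1 b) p = selfCount s (Finset.Ioc a (a + b)) p := by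
  refine Finset.card_nbij' (fun x => (a + x.1, a + x.2)) (fun x => (x.1 - a, x.2 - a)) ?_ ?_ ?_ ?_
  · rintro ⟨u, v⟩ h
    simp only [Finset.coe_filter, Finset.mem_product, Finset.mem_Icc, Set.mem_ofPred_eq,
      walk_shift, sub_sub_sub_cancel_right, Finset.mem_Ioc] at h ⊢
    exact ⟨by omega, h.2⟩
  · rintro ⟨u, v⟩ h
    simp only [Finset.coe_filter, Finset.mem_product, Finset.mem_Icc, Set.mem_ofPred_eq,
      walk_shift, sub_sub_sub_cancel_right, Finset.mem_Ioc] at h ⊢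
    rw [Nat.add_sub_cancel' (by omega), Nat.add_sub_cancel' (by omega)]
    exact ⟨by omega, h.2⟩
  · rintro ⟨u, v⟩ _
    simp
  · rintro ⟨u, v⟩ h
    simp only [Finset.coe_filter, Finset.mem_product, Set.mem_ofPred_eq, Finset.mem_Ioc] at h
    simp only [Prod.mk.injEq]
    omega

lemma IsRounding.tendsto_div {x : ℝ} (hx : 0 ≤ x) {a : ℕ → ℕ} (h : IsRounding x a) :
    Tendsto (fun n : ℕ => (a n : ℝ) / n) atTop (𝓝 x) := by
  have h1 : Tendsto (fun n : ℕ => 1 / (n : ℝ)) atTop (𝓝 0) := tendsto_one_div_atTop_nhds_zero_nat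
  have hlo : Tendsto (fun n : ℕ => x - 1 / (n : ℝ)) atTop (𝓝 x) := by
    simpa using tendsto_const_nhds.sub h1
  have hup : Tendsto (fun n : ℕ => x + 1 / (n : ℝ)) atTop (𝓝 x) := by
    simpa using tendsto_const_nhds.add h1
  refine tendsto_of_tendsto_of_tendsto_of_le_of_le' hlo hup ?_ ?_
  all_goals
    filter_upwards [eventually_gt_atTop 0] with n hn
    have hn' : (0 : ℝ) < n := by exact_mod_cast hn
    have h2 := Nat.floor_le (a := (n : ℝ) * x) (by positivity)
    have h3 := Nat.lt_floor_add_one ((n : ℝ) * x)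
  · rw [le_div_iff₀ hn', sub_mul, one_div, inv_mul_cancel₀ hn'.ne']
    rcases h n with h | h <;> rw [h] <;> push_cast <;> linarith
  · rw [div_le_iff₀ hn', add_mul, one_div, inv_mul_cancel₀ hn'.ne']
    rcases h n with h | h <;> rw [h] <;> push_cast <;> linarith

/-- Because `log (b n) = log n + O(1)`, the normalization by `b_n log b_n` may be traded for `n log
n`. -/
lemma tendsto_mul_log_ratio {b : ℕ → ℕ} {β : ℝ} (hβ : 0 < β)
    (hb : Tendsto (fun n : ℕ => (b n : ℝ) / n) atTop (𝓝 β)) :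
    Tendsto (fun n : ℕ => (b n * Real.log (b n)) / (n * Real.log n)) atTop (𝓝 β) := by
  have hlog : Tendsto (fun n : ℕ => Real.log n) atTop atTop :=
    Real.tendsto_log_atTop.comp tendsto_natCast_atTop_atTop
  have h1 : Tendsto (fun n : ℕ => Real.log ((b n : ℝ) / n) / Real.log n + 1) atTop
      (𝓝 (0 + 1)) := ((hb.log hβ.ne').div_atTop hlog).add_const 1
  have h2 := hb.mul h1
  rw [zero_add, mul_one] at h2
  refine h2.congr' ?_
  filter_upwards [eventually_gt_atTop 0, hlog.eventually_gt_atTop 0,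
    hb.eventually (lt_mem_nhds hβ)] with n hn hl hbn
  have hn' : (0 : ℝ) < n := by exact_mod_cast hn
  have hb0 : (0 : ℝ) < b n := by
    by_contra h
    exact absurd hbn (not_lt.2 (div_nonpos_of_nonpos_of_nonneg (not_lt.1 h) hn'.le))
  rw [Real.log_div hb0.ne' hn'.ne']
  field_simp
  ring

/-- The pathwise part: dyadic asymptotics of the self-intersection counts imply the asymptotics of
all counts over intervals of proportional length, and the negligibility of cross counts. -/
theorem counts_of_dyadic (s : ℕ → (Fin 2 → ℤ)) {C : ℝ} (hC : 0 < C) (p : Fin 2 → ℤ)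
    (H : ∀ i j : ℕ, i ≤ j → Tendsto (fun k : ℕ =>
      (selfCount s (Finset.Ioc (i * 2 ^ k) (j * 2 ^ k)) p : ℝ) / (2 ^ k * k)) atTop
        (𝓝 (C * (j - i) * Real.log 2)))
    {A : ℝ} (hA0 : 0 < A) (hA1 : A < 1) {a a' b : ℕ → ℕ} (ha : IsRounding A a)
    (ha' : IsRounding A a') (hb : IsRounding (1 - A) b) :
    Tendsto (fun n : ℕ => normalizedCount C (shift (a n) s) (b n) p) atTop (𝓝 1) ∧
    Tendsto (fun n : ℕ => (selfCount s (Finset.Icc (a n) n) p : ℝ) /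
      (C * (n * (1 - A)) * Real.log n)) atTop (𝓝 1) ∧
    (fun n : ℕ => (crossCount s (Finset.Icc 1 (a n)) (Finset.Icc (a' n) n) p : ℝ) +
      (crossCount s (Finset.Icc (a' n) n) (Finset.Icc 1 (a n)) p : ℝ))
        =o[atTop] (fun n : ℕ => (n : ℝ) * Real.log n) := by
  have hlog : Tendsto (fun n : ℕ => Real.log n) atTop atTop :=
    Real.tendsto_log_atTop.comp tendsto_natCast_atTop_atTop
  have hW := @tendsto_of_dyadic (fun l r => (selfCount s (Finset.Ioc l r) p : ℝ)) C hC.le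
    (fun hl hr => by
      exact_mod_cast crossCount_mono s (Finset.Ioc_subset_Ioc hl hr)
        (Finset.Ioc_subset_Ioc hl hr) p)
    (fun _ _ => Nat.cast_nonneg _) H
  have hB : 0 < 1 - A := by linarith
  have hta := ha.tendsto_div hA0.le
  have hta' := ha'.tendsto_div hA0.le
  have htb := hb.tendsto_div hB.le
  have h1n : Tendsto (fun n : ℕ => (1 : ℝ) / n) atTop (𝓝 0) := tendsto_one_div_atTop_nhds_zero_nat
  have htn : Tendsto (fun n : ℕ => (n : ℝ) / n) atTop (𝓝 1) :=
    tendsto_const_nhds.congr' (by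
      filter_upwards [eventually_gt_atTop 0] with n hn
      rw [div_self (by exact_mod_cast hn.ne')])
  have h0n : Tendsto (fun n : ℕ => ((0 : ℕ) : ℝ) / n) atTop (𝓝 0) := by simp
  have hapos : ∀ᶠ n : ℕ in atTop, 0 < a n := by
    filter_upwards [hta.eventually (lt_mem_nhds hA0), eventually_gt_atTop 0] with n h hn
    rcases Nat.eq_zero_or_pos (a n) with h0 | h0
    · simp [h0] at h
    · exact h0
  refine ⟨?_, ?_, ?_⟩
  · have htab : Tendsto (fun n : ℕ => ((a n + b n : ℕ) : ℝ) / n) atTop (𝓝 1) := by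
      have := hta.add htb
      simp only [← add_div] at this
      simpa using this
    have h := (hW hta htab hA1).div ((tendsto_mul_log_ratio hB htb).const_mul C)
      (by positivity)
    rw [div_self (by positivity)] at h
    refine h.congr' ?_
    filter_upwards [eventually_gt_atTop 0, hlog.eventually_gt_atTop 0] with n hn hl
    have hn' : (0 : ℝ) < n := by exact_mod_cast hn
    simp only [normalizedCount, selfCount_shift, Pi.div_apply]
    field_simp
  · have hta1 : Tendsto (fun n : ℕ => ((a n - 1 : ℕ) : ℝ) / n) atTop (𝓝 A) := by
      have := hta.sub h1n
      rw [sub_zero] at this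
      refine this.congr' ?_
      filter_upwards [hapos] with n hn
      rw [Nat.cast_sub hn, ← sub_div, Nat.cast_one]
    have h := (hW hta1 htn hA1).div_const (C * (1 - A))
    rw [div_self (by positivity)] at h
    refine h.congr' ?_
    filter_upwards [eventually_gt_atTop 0, hlog.eventually_gt_atTop 0, hapos] with n hn hl ha0
    have hI : Finset.Ioc (a n - 1) n = Finset.Icc (a n) n := by
      ext x; simp only [Finset.mem_Ioc, Finset.mem_Icc]; omega
    have hn' : (0 : ℝ) < n := by exact_mod_cast hn
    rw [hI]
    field_simp
  -- The two roundings may differ by one in either direction. Dropping the points `a'` and `a' + 1`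
  -- makes the time sets disjoint; the dropped points contribute at most `4 a n` pairs, which is
  -- negligible against `n log n`.
  · have hta2 : Tendsto (fun n : ℕ => ((a' n + 1 : ℕ) : ℝ) / n) atTop (𝓝 A) := by
      have := hta'.add h1n
      simpa only [← add_div, add_zero, Nat.cast_add, Nat.cast_one] using this
    have hfull := hW h0n htn one_pos
    have hleft := hW h0n hta hA0
    have hright := hW hta2 htn hA1
    have hsq : Tendsto (fun n : ℕ => 4 * ((a n : ℝ) / n) / Real.log n) atTop (𝓝 0) :=
      (hta.const_mul 4).div_atTop hlog
    have hsum := ((hfull.sub hleft).sub hright).add hsq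
    have hz : C * (1 - 0) - C * (A - 0) - C * (1 - A) + 0 = 0 := by ring
    rw [hz] at hsum
    -- The maximum covers the small `n` at which the rounding exceeds `n`, for instance `n = 0`.
    have hcount : ∀ n : ℕ,
        crossCount s (Finset.Icc 1 (a n)) (Finset.Icc (a' n) n) p +
          crossCount s (Finset.Icc (a' n) n) (Finset.Icc 1 (a n)) p +
          selfCount s (Finset.Ioc 0 (a n)) p + selfCount s (Finset.Ioc (a' n + 1) n) p ≤
        selfCount s (Finset.Ioc 0 (max (a n) n)) p + 4 * a n := by
      intro n
      have haa : a n ≤ a' n + 1 := by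
        rcases ha n with h | h <;> rcases ha' n with h' | h' <;> omega
      have hI : Finset.Icc 1 (a n) = Finset.Ioc 0 (a n) := rfl
      have hcov : Finset.Icc (a' n) n ⊆ {a' n, a' n + 1} ∪ Finset.Ioc (a' n + 1) n := by
        intro x
        simp only [Finset.mem_Icc, Finset.mem_union, Finset.mem_insert, Finset.mem_singleton,
          Finset.mem_Ioc]
        omega
      have hdis : Disjoint {a' n, a' n + 1} (Finset.Ioc (a' n + 1) n) := by
        rw [Finset.disjoint_left]
        intro x
        simp only [Finset.mem_insert, Finset.mem_singleton, Finset.mem_Ioc]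
        omega
      have hdis2 : Disjoint (Finset.Ioc 0 (a n)) (Finset.Ioc (a' n + 1) n) := by
        rw [Finset.disjoint_left]
        intro x
        simp only [Finset.mem_Ioc]
        omega
      have hsub : Finset.Ioc 0 (a n) ∪ Finset.Ioc (a' n + 1) n ⊆ Finset.Ioc 0 (max (a n) n) := by
        intro x
        simp only [Finset.mem_union, Finset.mem_Ioc]
        omega
      have hcard : ({a' n, a' n + 1} : Finset ℕ).card ≤ 2 := Finset.card_le_two
      have hcI : (Finset.Ioc 0 (a n)).card = a n := by simp
      have e1 := crossCount_mono s (le_refl (Finset.Ioc 0 (a n))) hcov p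
      have e2 := crossCount_mono s hcov (le_refl (Finset.Ioc 0 (a n))) p
      rw [crossCount_union_right s _ hdis] at e1
      rw [crossCount_union_left s hdis] at e2
      have e3 := crossCount_le s (Finset.Ioc 0 (a n)) {a' n, a' n + 1} p
      have e4 := crossCount_le s {a' n, a' n + 1} (Finset.Ioc 0 (a n)) p
      have e5 : selfCount s _ p ≤ selfCount s _ p := crossCount_mono s hsub hsub p
      rw [selfCount_union s hdis2] at e5
      rw [hcI] at e3 e4
      rw [hI]
      have e6 : a n * ({a' n, a' n + 1} : Finset ℕ).card ≤ a n * 2 := Nat.mul_le_mul_left _ hcard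
      have e7 : ({a' n, a' n + 1} : Finset ℕ).card * a n ≤ 2 * a n := Nat.mul_le_mul_right _ hcard
      omega
    have han : ∀ᶠ n : ℕ in atTop, a n ≤ n := by
      filter_upwards [hta.eventually (gt_mem_nhds hA1), eventually_gt_atTop 0] with n h hn
      rw [div_lt_one (by exact_mod_cast hn)] at h
      exact_mod_cast h.le
    refine (isLittleO_iff_tendsto' ?_).2 (squeeze_zero' ?_ ?_ hsum)
    · filter_upwards [eventually_gt_atTop 0, hlog.eventually_gt_atTop 0] with n hn hl h
      have hn' : (0 : ℝ) < n := by exact_mod_cast hn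
      exact absurd h (by positivity)
    · filter_upwards [hlog.eventually_gt_atTop 0] with n hl
      positivity
    · filter_upwards [eventually_gt_atTop 0, hlog.eventually_gt_atTop 0, han] with n hn hl hle
      have hn' : (0 : ℝ) < n := by exact_mod_cast hn
      have h := hcount n
      rw [max_eq_right hle] at h
      have h' : (crossCount s (Finset.Icc 1 (a n)) (Finset.Icc (a' n) n) p : ℝ) +
          crossCount s (Finset.Icc (a' n) n) (Finset.Icc 1 (a n)) p +
          selfCount s (Finset.Ioc 0 (a n)) p + selfCount s (Finset.Ioc (a' n + 1) n) p ≤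
        selfCount s (Finset.Ioc 0 n) p + 4 * a n := by exact_mod_cast h
      have e : 4 * ((a n : ℝ) / n) / Real.log n = 4 * a n / (n * Real.log n) := by
        field_simp
      rw [e, ← sub_div, ← sub_div, ← add_div]
      exact div_le_div_of_nonneg_right (by linarith) (by positivity)

/-! ### Independence of increments over disjoint blocks of steps. -/

/-- The increment `Z_v - Z_u` of the walk with steps `ζ`. -/
def incr {Ω : Type*} (ζ : ℕ → Ω → (Fin 2 → ℤ)) (u v : ℕ) (ω : Ω) : Fin 2 → ℤ :=
  walk (fun i => ζ i ω) v - walk (fun i => ζ i ω) u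

/-- The `σ`-algebra generated by the steps with index in `S`. -/
@[reducible] def stepAlg {Ω : Type*} (ζ : ℕ → Ω → (Fin 2 → ℤ)) (S : Set ℕ) : MeasurableSpace Ω :=
  ⨆ i ∈ S, MeasurableSpace.comap (ζ i) inferInstance

section Independence

variable {Ω : Type*} {ζ : ℕ → Ω → (Fin 2 → ℤ)}

lemma incr_eq_sum {u v : ℕ} (h : u ≤ v) (ω : Ω) :
    incr ζ u v ω = ∑ i ∈ Finset.Ico u v, ζ i ω := by
  rw [Finset.sum_Ico_eq_sub _ h]; rfl

lemma incr_add (u v w : ℕ) (ω : Ω) : incr ζ u v ω + incr ζ v w ω = incr ζ u w ω := by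
  simp [incr]

lemma measurable_incr_stepAlg {u v : ℕ} (h : u ≤ v) {S : Set ℕ} (hS : Set.Ico u v ⊆ S) :
    Measurable[stepAlg ζ S] (incr ζ u v) := by
  have : incr ζ u v = fun ω => ∑ i ∈ Finset.Ico u v, ζ i ω := funext (incr_eq_sum h)
  rw [this]
  let _ := stepAlg ζ S
  refine Finset.measurable_sum _ fun i hi => ?_
  have hi' : i ∈ S := hS (by simpa using hi)
  exact (comap_measurable (ζ i)).mono (le_iSup₂_of_le i hi' le_rfl) le_rfl

variable [MeasurableSpace Ω] {P : Measure Ω}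

lemma stepAlg_le (hm : ∀ i, Measurable (ζ i)) (S : Set ℕ) :
    stepAlg ζ S ≤ ‹MeasurableSpace Ω› :=
  iSup₂_le fun i _ => (hm i).comap_le

lemma measurable_incr (hm : ∀ i, Measurable (ζ i)) {u v : ℕ} (h : u ≤ v) :
    Measurable (incr ζ u v) :=
  (measurable_incr_stepAlg h (Set.subset_univ _)).mono (stepAlg_le hm _) le_rfl

lemma indep_stepAlg (hm : ∀ i, Measurable (ζ i)) (hi : iIndepFun ζ P) {S T : Set ℕ}
    (h : Disjoint S T) : Indep (stepAlg ζ S) (stepAlg ζ T) P :=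
  indep_iSup_of_disjoint (fun i => (hm i).comap_le) hi.iIndep h

lemma indepFun_of_stepAlg {β γ : Type*} [MeasurableSpace β] [MeasurableSpace γ]
    (hm : ∀ i, Measurable (ζ i)) (hi : iIndepFun ζ P) {S T : Set ℕ} (h : Disjoint S T)
    {X : Ω → β} {Y : Ω → γ} (hX : Measurable[stepAlg ζ S] X) (hY : Measurable[stepAlg ζ T] Y) :
    IndepFun X Y P := by
  rw [IndepFun_iff_Indep]
  exact indep_of_indep_of_le_left (indep_of_indep_of_le_right (indep_stepAlg hm hi h)
    hY.comap_le) hX.comap_le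

/-- If `X` is independent of `Y` and has no atom above `M`, then it hits a function of `Y`
on an event depending on `Y` with probability at most `M` times that of the event. -/
lemma measureReal_eq_comp_le [IsProbabilityMeasure P] {β γ : Type*} [MeasurableSpace β]
    [Countable β] [DiscreteMeasurableSpace β] [MeasurableSpace γ]
    [Countable γ] [DiscreteMeasurableSpace γ] {X : Ω → β} {Y : Ω → γ} (hX : Measurable X)
    (hY : Measurable Y) (h : IndepFun X Y P) {M : ℝ}
    (hM : ∀ x, P.real {ω | X ω = x} ≤ M) (g : γ → β) (E : Set γ) :
    P.real {ω | X ω = g (Y ω) ∧ Y ω ∈ E} ≤ M * P.real {ω | Y ω ∈ E} := by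
  have hM0 : 0 ≤ M := measureReal_nonneg.trans (hM (g (Y (nonempty_of_isProbabilityMeasure P).some)))
  have hset : MeasurableSet {z : β × γ | z.1 = g z.2 ∧ z.2 ∈ E} := MeasurableSet.of_discrete
  have hmap := (indepFun_iff_map_prod_eq_prod_map_map hX.aemeasurable hY.aemeasurable).1 h
  have hle : P {ω | X ω = g (Y ω) ∧ Y ω ∈ E} ≤ ENNReal.ofReal M * P {ω | Y ω ∈ E} := by
    have : IsProbabilityMeasure (P.map X) := Measure.isProbabilityMeasure_map hX.aemeasurable
    have : IsProbabilityMeasure (P.map Y) := Measure.isProbabilityMeasure_map hY.aemeasurable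
    calc P {ω | X ω = g (Y ω) ∧ Y ω ∈ E}
        = (P.map fun ω => (X ω, Y ω)) {z : β × γ | z.1 = g z.2 ∧ z.2 ∈ E} := by
          rw [Measure.map_apply (hX.prodMk hY) hset]; rfl
      _ = ∫⁻ y, (P.map X) ((fun x => (x, y)) ⁻¹' {z : β × γ | z.1 = g z.2 ∧ z.2 ∈ E})
            ∂(P.map Y) := by rw [hmap, Measure.prod_apply_symm hset]
      _ ≤ ∫⁻ y, E.indicator (fun _ => ENNReal.ofReal M) y ∂(P.map Y) := by
          refine lintegral_mono fun y => ?_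
          by_cases hy : y ∈ E
          · rw [Set.indicator_of_mem hy, Measure.map_apply hX (MeasurableSet.of_discrete)]
            refine (ENNReal.le_ofReal_iff_toReal_le (measure_ne_top _ _) hM0).2 ?_
            have hpre : X ⁻¹' ((fun x => (x, y)) ⁻¹' {z : β × γ | z.1 = g z.2 ∧ z.2 ∈ E}) =
                {ω | X ω = g y} := by
              ext ω; simp [hy]
            rw [hpre]
            exact hM (g y)
          · simp [hy]
      _ = ENNReal.ofReal M * P {ω | Y ω ∈ E} := by
          rw [lintegral_indicator (MeasurableSet.of_discrete), setLIntegral_const,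
            Measure.map_apply hY (MeasurableSet.of_discrete)]
          rfl
  have := ENNReal.toReal_mono (by finiteness) hle
  rwa [ENNReal.toReal_mul, ENNReal.toReal_ofReal hM0] at this

lemma measureReal_eq_comp_le' [IsProbabilityMeasure P] {β γ : Type*} [MeasurableSpace β]
    [Countable β] [DiscreteMeasurableSpace β] [MeasurableSpace γ]
    [Countable γ] [DiscreteMeasurableSpace γ] {X : Ω → β} {Y : Ω → γ} (hX : Measurable X)
    (hY : Measurable Y) (h : IndepFun X Y P) {M : ℝ}
    (hM : ∀ x, P.real {ω | X ω = x} ≤ M) (g : γ → β) :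
    P.real {ω | X ω = g (Y ω)} ≤ M := by
  simpa using measureReal_eq_comp_le hX hY h hM g Set.univ

/-- Two overlapping increments of the walk, with endpoints `u₁ ≤ u₂ ≤ v₁ ≤ v₂`. -/
lemma measureReal_overlap_le [IsProbabilityMeasure P] (hm : ∀ i, Measurable (ζ i))
    (hi : iIndepFun ζ P) {K : ℝ}
    (hK : ∀ u v x, u ≤ v → P.real {ω | incr ζ u v ω = x} ≤ K / ((v - u : ℕ) + 1))
    {u₁ u₂ v₁ v₂ : ℕ} (hu : u₁ ≤ u₂) (huv : u₂ ≤ v₁) (hv : v₁ ≤ v₂)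
    (f g : (Fin 2 → ℤ) → (Fin 2 → ℤ)) (hg : Function.Injective g) :
    P.real {ω | incr ζ u₂ v₁ ω = f (incr ζ u₁ u₂ ω) ∧ g (incr ζ u₁ u₂ ω) = incr ζ v₁ v₂ ω} ≤
      K / ((v₁ - u₂ : ℕ) + 1) * (K / ((max (u₂ - u₁) (v₂ - v₁) : ℕ) + 1)) := by
  have hA : Measurable[stepAlg ζ (Set.Ico u₁ u₂)] (incr ζ u₁ u₂) :=
    measurable_incr_stepAlg hu subset_rfl
  have hB : Measurable[stepAlg ζ (Set.Ico u₂ v₁)] (incr ζ u₂ v₁) :=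
    measurable_incr_stepAlg huv subset_rfl
  have hC : Measurable[stepAlg ζ (Set.Ico v₁ v₂)] (incr ζ v₁ v₂) :=
    measurable_incr_stepAlg hv subset_rfl
  have hA' : Measurable[stepAlg ζ (Set.Ico u₂ v₁)ᶜ] (incr ζ u₁ u₂) :=
    measurable_incr_stepAlg hu fun x hx => by simp at hx ⊢; omega
  have hC' : Measurable[stepAlg ζ (Set.Ico u₂ v₁)ᶜ] (incr ζ v₁ v₂) :=
    measurable_incr_stepAlg hv fun x hx => by simp at hx ⊢; omega
  have hAC : Disjoint (Set.Ico u₁ u₂) (Set.Ico v₁ v₂) := by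
    rw [Set.disjoint_left]; intro x hx hx'; simp at hx hx'; omega
  have iAC : IndepFun (incr ζ u₁ u₂) (incr ζ v₁ v₂) P := indepFun_of_stepAlg hm hi hAC hA hC
  have iB : IndepFun (incr ζ u₂ v₁) (fun ω => (incr ζ u₁ u₂ ω, incr ζ v₁ v₂ ω)) P :=
    indepFun_of_stepAlg hm hi disjoint_compl_right hB (hA'.prodMk hC')
  have mA := measurable_incr hm hu
  have mB := measurable_incr hm huv
  have mC := measurable_incr hm hv
  have h1 := measureReal_eq_comp_le mB (mA.prodMk mC) iB (fun x => hK u₂ v₁ x huv)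
    (fun z => f z.1) {z | g z.1 = z.2}
  -- The middle increment has been conditioned away. In the remaining relation between the outer
  -- increments either one determines the other, because `g` is injective, so the longer one can be
  -- used for the atom bound.
  refine h1.trans (mul_le_mul_of_nonneg_left ?_ ?_)
  · rcases le_total (v₂ - v₁) (u₂ - u₁) with h | h
    · rw [max_eq_left h]
      refine le_trans (measureReal_mono ?_) (measureReal_eq_comp_le' mA mC iAC
        (fun x => hK u₁ u₂ x hu) (Function.invFun g))
      intro ω hω
      change incr ζ u₁ u₂ ω = _
      rw [← show g (incr ζ u₁ u₂ ω) = incr ζ v₁ v₂ ω from hω, Function.leftInverse_invFun hg]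
    · rw [max_eq_right h]
      refine le_trans (measureReal_mono ?_) (measureReal_eq_comp_le' mC mA iAC.symm
        (fun x => hK v₁ v₂ x hv) g)
      intro ω hω
      exact (show g (incr ζ u₁ u₂ ω) = incr ζ v₁ v₂ ω from hω).symm
  · exact measureReal_nonneg.trans (hK u₂ v₁ 0 huv)

end Independence

/-! ### Second moment of cross counts, variance of self-counts, and convergence along dyadic scales.
-/

/-- The weight `(n + 1)^{-1/2}`. -/
noncomputable def sqrtWeight (n : ℕ) : ℝ := 1 / Real.sqrt (n + 1)

lemma sqrtWeight_nonneg (n : ℕ) : 0 ≤ sqrtWeight n := by unfold sqrtWeight; positivity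

lemma sum_sqrtWeight_le (N : ℕ) :
    ∑ n ∈ Finset.range N, sqrtWeight n ≤ 2 * Real.sqrt N := by
  induction N with
  | zero => simp
  | succ N ih =>
    rw [Finset.sum_range_succ]
    have h0 : 0 < Real.sqrt (N + 1 : ℝ) := Real.sqrt_pos.2 (by positivity)
    have h1 := Real.sq_sqrt (show (0 : ℝ) ≤ N + 1 by positivity)
    have h2 := Real.sq_sqrt (show (0 : ℝ) ≤ N by positivity)
    have h3 : sqrtWeight N ≤ 2 * Real.sqrt (N + 1 : ℝ) - 2 * Real.sqrt N := by
      rw [sqrtWeight, div_le_iff₀ h0]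
      nlinarith [sq_nonneg (Real.sqrt (N + 1 : ℝ) - Real.sqrt N)]
    push_cast
    linarith

lemma one_div_le_sqrtWeight_mul {x y z : ℕ} (h : (x + 1) * (y + 1) ≤ (z + 1) ^ 2) :
    1 / ((z : ℝ) + 1) ≤ sqrtWeight x * sqrtWeight y := by
  rw [sqrtWeight, sqrtWeight, one_div_mul_one_div, ← Real.sqrt_mul (by positivity)]
  refine one_div_le_one_div_of_le (Real.sqrt_pos.2 (by positivity)) ?_
  exact Real.sqrt_le_iff.2 ⟨by positivity, by exact_mod_cast h⟩

/-- The weight of a pair of indices in the second moment of the cross counts. -/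
noncomputable def pairWeight (i i' : ℕ) : ℝ :=
  sqrtWeight (min i i') * sqrtWeight (max i i' - min i i')

lemma pairWeight_nonneg (i i' : ℕ) : 0 ≤ pairWeight i i' :=
  mul_nonneg (sqrtWeight_nonneg _) (sqrtWeight_nonneg _)

lemma pairWeight_comm (i i' : ℕ) : pairWeight i i' = pairWeight i' i := by
  rw [pairWeight, pairWeight, min_comm, max_comm]

/-- On the half `i ≤ i'`, the variables `i` and `i' - i` separate and the sum is at most `(2√N)² =
4N`. -/
lemma sum_pairWeight_le (N : ℕ) :
    ∑ i ∈ Finset.range N, ∑ i' ∈ Finset.range N, pairWeight i i' ≤ 8 * N := by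
  have hS : ∀ i ∈ Finset.range N,
      (∑ i' ∈ Finset.range N, if i ≤ i' then pairWeight i i' else 0) ≤
        sqrtWeight i * ∑ d ∈ Finset.range N, sqrtWeight d := by
    intro i hi
    have hf : (Finset.range N).filter (fun i' => i ≤ i') = Finset.Ico i N := by
      ext x; simp [and_comm]
    rw [← Finset.sum_filter, hf, Finset.sum_Ico_eq_sum_range, Finset.mul_sum]
    have : ∀ d ∈ Finset.range (N - i), pairWeight i (i + d) = sqrtWeight i * sqrtWeight d := by
      intro d _
      simp [pairWeight]
    rw [Finset.sum_congr rfl this]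
    exact Finset.sum_le_sum_of_subset_of_nonneg (Finset.range_mono (Nat.sub_le _ _))
      fun d _ _ => mul_nonneg (sqrtWeight_nonneg _) (sqrtWeight_nonneg _)
  have hhalf : ∑ i ∈ Finset.range N, ∑ i' ∈ Finset.range N,
      (if i ≤ i' then pairWeight i i' else 0) ≤ 4 * N := by
    refine (Finset.sum_le_sum hS).trans ?_
    rw [← Finset.sum_mul]
    have h1 := sum_sqrtWeight_le N
    have h0 : 0 ≤ ∑ n ∈ Finset.range N, sqrtWeight n :=
      Finset.sum_nonneg fun n _ => sqrtWeight_nonneg n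
    have h2 := Real.sq_sqrt (show (0 : ℝ) ≤ N by positivity)
    nlinarith [Real.sqrt_nonneg (N : ℝ)]
  have hle : ∀ i ∈ Finset.range N, ∀ i' ∈ Finset.range N, pairWeight i i' ≤
      (if i ≤ i' then pairWeight i i' else 0) + (if i' ≤ i then pairWeight i' i else 0) := by
    intro i _ i' _
    have h1 := pairWeight_nonneg i i'
    rw [pairWeight_comm i' i]
    split_ifs <;> first | omega | linarith
  refine (Finset.sum_le_sum fun i hi => Finset.sum_le_sum (hle i hi)).trans ?_
  simp only [Finset.sum_add_distrib]
  rw [Finset.sum_comm (f := fun i i' => if i' ≤ i then pairWeight i' i else 0)]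
  linarith

section SecondMoment

variable {Ω : Type*} {ζ : ℕ → Ω → (Fin 2 → ℤ)} [MeasurableSpace Ω] {P : Measure Ω}
  [IsProbabilityMeasure P]

/-- The two increments share the middle piece, so subtracting the two equations forces the outer
pieces to be equal. -/
lemma measureReal_interlaced_le (hm : ∀ i, Measurable (ζ i))
    (hi : iIndepFun ζ P) {K : ℝ}
    (hK : ∀ u v x, u ≤ v → P.real {ω | incr ζ u v ω = x} ≤ K / ((v - u : ℕ) + 1))
    {u₁ u₂ v₁ v₂ : ℕ} (hu : u₁ ≤ u₂) (huv : u₂ ≤ v₁) (hv : v₁ ≤ v₂) (p : Fin 2 → ℤ) :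
    P.real ({ω | incr ζ u₁ v₁ ω = p} ∩ {ω | incr ζ u₂ v₂ ω = p}) ≤
      K / ((v₁ - u₂ : ℕ) + 1) * (K / ((max (u₂ - u₁) (v₂ - v₁) : ℕ) + 1)) := by
  refine le_trans (measureReal_mono ?_) (measureReal_overlap_le hm hi hK hu huv hv
    (fun x => p - x) id Function.injective_id)
  rintro ω ⟨h1, h2⟩
  simp only [Set.mem_ofPred_eq, id] at h1 h2 ⊢
  rw [← incr_add u₁ u₂ v₁] at h1
  rw [← incr_add u₂ v₁ v₂] at h2
  constructor
  · rw [← h1]; abel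
  · rw [← h2, add_comm] at h1
    exact add_left_cancel h1

/-- The inner increment is already `p`, so the two outer pieces must cancel. -/
lemma measureReal_nested_le (hm : ∀ i, Measurable (ζ i))
    (hi : iIndepFun ζ P) {K : ℝ}
    (hK : ∀ u v x, u ≤ v → P.real {ω | incr ζ u v ω = x} ≤ K / ((v - u : ℕ) + 1))
    {u₁ u₂ v₁ v₂ : ℕ} (hu : u₁ ≤ u₂) (huv : u₂ ≤ v₁) (hv : v₁ ≤ v₂) (p : Fin 2 → ℤ) :
    P.real ({ω | incr ζ u₁ v₂ ω = p} ∩ {ω | incr ζ u₂ v₁ ω = p}) ≤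
      K / ((v₁ - u₂ : ℕ) + 1) * (K / ((max (u₂ - u₁) (v₂ - v₁) : ℕ) + 1)) := by
  refine le_trans (measureReal_mono ?_) (measureReal_overlap_le hm hi hK hu huv hv
    (fun _ => p) (fun x => -x) neg_injective)
  rintro ω ⟨h1, h2⟩
  simp only [Set.mem_ofPred_eq] at h1 h2 ⊢
  refine ⟨h2, ?_⟩
  rw [← incr_add u₁ u₂ v₂, ← incr_add u₂ v₁ v₂, h2] at h1
  have : incr ζ u₁ u₂ ω + incr ζ v₁ v₂ ω = 0 := by
    have h3 : p + (incr ζ u₁ u₂ ω + incr ζ v₁ v₂ ω) = p + 0 := by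
      rw [add_zero]; nth_rewrite 2 [← h1]; abel
    exact add_left_cancel h3
  exact neg_eq_of_add_eq_zero_right this

/-- Each denominator dominates a geometric mean, which decouples the left indices from the right
ones. The fourfold sum in the second moment thereby becomes a product of two double sums. -/
lemma overlap_bound_le_weights {K : ℝ} {b x y M a c : ℕ} (hb : b = x + y + 1)
    (hM : M = max a c) :
    K / ((b : ℕ) + 1) * (K / ((M : ℕ) + 1)) ≤
      K ^ 2 * ((sqrtWeight x * sqrtWeight a) * (sqrtWeight y * sqrtWeight c)) := by
  have h1 : 1 / ((b : ℝ) + 1) ≤ sqrtWeight x * sqrtWeight y :=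
    one_div_le_sqrtWeight_mul (by subst hb; nlinarith)
  have h2 : 1 / ((M : ℝ) + 1) ≤ sqrtWeight a * sqrtWeight c :=
    one_div_le_sqrtWeight_mul (by
      have ha : a ≤ M := hM ▸ le_max_left _ _
      have hc : c ≤ M := hM ▸ le_max_right _ _
      nlinarith)
  calc K / ((b : ℕ) + 1) * (K / ((M : ℕ) + 1))
      = K ^ 2 * (1 / ((b : ℝ) + 1) * (1 / ((M : ℝ) + 1))) := by ring
    _ ≤ K ^ 2 * ((sqrtWeight x * sqrtWeight y) * (sqrtWeight a * sqrtWeight c)) := by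
        gcongr
        exact mul_nonneg (sqrtWeight_nonneg _) (sqrtWeight_nonneg _)
    _ = _ := by ring

lemma measureReal_two_incr_le (hm : ∀ i, Measurable (ζ i)) (hi : iIndepFun ζ P) {K : ℝ}
    (hK : ∀ u v x, u ≤ v → P.real {ω | incr ζ u v ω = x} ≤ K / ((v - u : ℕ) + 1))
    (m : ℕ) {i i' : ℕ} (him : i ≤ m) (him' : i' ≤ m) (j j' : ℕ) (p : Fin 2 → ℤ) :
    P.real ({ω | incr ζ (m - i) (m + 1 + j) ω = p} ∩ {ω | incr ζ (m - i') (m + 1 + j') ω = p}) ≤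
      K ^ 2 * (pairWeight i i' * pairWeight j j') := by
  wlog hii : i' ≤ i generalizing i i' j j'
  · rw [Set.inter_comm, pairWeight_comm i, pairWeight_comm j]
    exact this him' him j' j (le_of_not_ge hii)
  rw [pairWeight, pairWeight, min_eq_right hii, max_eq_left hii]
  rcases le_total j j' with hj | hj
  · rw [min_eq_left hj, max_eq_right hj]
    refine (measureReal_interlaced_le hm hi hK (by omega) (by omega) (by omega) p).trans
      (overlap_bound_le_weights (by omega) (by congr 1 <;> omega))
  · rw [min_eq_right hj, max_eq_left hj]
    refine (measureReal_nested_le hm hi hK (by omega) (by omega) (by omega) p).trans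
      (overlap_bound_le_weights (by omega) (by congr 1 <;> omega))

lemma integral_sq_sum_indicator {ι : Type*} (s : Finset ι) {e : ι → Set Ω}
    (he : ∀ z, MeasurableSet (e z)) :
    ∫ ω, (∑ z ∈ s, (e z).indicator (fun _ => (1 : ℝ)) ω) ^ 2 ∂P =
      ∑ z ∈ s, ∑ z' ∈ s, P.real (e z ∩ e z') := by
  have h1 : ∀ z z', ∀ ω, (e z).indicator (fun _ => (1 : ℝ)) ω *
      (e z').indicator (fun _ => (1 : ℝ)) ω = (e z ∩ e z').indicator 1 ω := by
    intro z z' ω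
    by_cases hz : ω ∈ e z <;> by_cases hz' : ω ∈ e z' <;> simp [hz, hz']
  have hint : ∀ z z', Integrable ((e z ∩ e z').indicator (1 : Ω → ℝ)) P := fun z z' =>
    (integrable_const (1 : ℝ)).indicator ((he z).inter (he z'))
  simp only [sq, Finset.sum_mul_sum, h1]
  rw [integral_finsetSum _ fun z _ => integrable_finsetSum _ fun z' _ => hint z z']
  refine Finset.sum_congr rfl fun z _ => ?_
  rw [integral_finsetSum _ fun z' _ => hint z z']
  exact Finset.sum_congr rfl fun z' _ => integral_indicator_one ((he z).inter (he z'))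

lemma crossCount_blocks_eq {m N : ℕ} (hN : N ≤ m) (p : Fin 2 → ℤ) (ω : Ω) :
    (crossCount (fun i => ζ i ω) (Finset.Ioc (m - N) m) (Finset.Ioc m (m + N)) p : ℝ) =
      ∑ z ∈ (Finset.range N) ×ˢ (Finset.range N),
        {ω | incr ζ (m - z.1) (m + 1 + z.2) ω = -p}.indicator (fun _ => (1 : ℝ)) ω := by
  have hL : ∀ f : ℕ → ℝ, ∑ u ∈ Finset.Ioc (m - N) m, f u = ∑ i ∈ Finset.range N, f (m - i) := by
    intro f
    refine Finset.sum_nbij' (fun u => m - u) (fun i => m - i) ?_ ?_ ?_ ?_ ?_ <;> intro u hu <;>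
      simp only [Finset.mem_Ioc, Finset.mem_range] at hu ⊢ <;> try omega
    rw [Nat.sub_sub_self hu.2]
  have hR : ∀ f : ℕ → ℝ, ∑ v ∈ Finset.Ioc m (m + N), f v =
      ∑ j ∈ Finset.range N, f (m + 1 + j) := by
    intro f
    refine Finset.sum_nbij' (fun u => u - (m + 1)) (fun j => m + 1 + j) ?_ ?_ ?_ ?_ ?_ <;>
      intro u hu <;> simp only [Finset.mem_Ioc, Finset.mem_range] at hu ⊢ <;> try omega
    rw [Nat.add_sub_cancel' (by omega)]
  rw [crossCount_eq_sum, Finset.sum_product]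
  push_cast
  rw [hL]
  refine Finset.sum_congr rfl fun i _ => ?_
  rw [hR]
  refine Finset.sum_congr rfl fun j _ => ?_
  simp only [Set.indicator_apply, Set.mem_ofPred_eq, incr]
  congr 1
  rw [← neg_sub, neg_eq_iff_eq_neg]

lemma measurable_natCast_crossCount (hm : ∀ i, Measurable (ζ i)) (I J : Finset ℕ)
    (p : Fin 2 → ℤ) : Measurable fun ω => (crossCount (fun i => ζ i ω) I J p : ℝ) := by
  have hw : ∀ n, Measurable fun ω => walk (fun i => ζ i ω) n := fun n =>
    Finset.measurable_sum _ fun i _ => hm i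
  simp only [crossCount_eq_sum]
  push_cast
  refine Finset.measurable_sum _ fun u _ => Finset.measurable_sum _ fun v _ => ?_
  exact Measurable.ite ((hw u).sub (hw v) (measurableSet_singleton p)) measurable_const
    measurable_const

lemma measurable_natCast_selfCount (hm : ∀ i, Measurable (ζ i)) (I : Finset ℕ)
    (p : Fin 2 → ℤ) : Measurable fun ω => (selfCount (fun i => ζ i ω) I p : ℝ) :=
  measurable_natCast_crossCount hm I I p

lemma memLp_crossCount (hm : ∀ i, Measurable (ζ i)) (I J : Finset ℕ) (p : Fin 2 → ℤ) :
    MemLp (fun ω => (crossCount (fun i => ζ i ω) I J p : ℝ)) 2 P :=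
  MemLp.of_bound (measurable_natCast_crossCount hm I J p).aestronglyMeasurable
    ((I.card * J.card : ℕ) : ℝ) (Eventually.of_forall fun ω => by
      rw [Real.norm_of_nonneg (Nat.cast_nonneg _)]
      exact_mod_cast crossCount_le _ I J p)

lemma integral_sq_crossCount_le (hm : ∀ i, Measurable (ζ i)) (hi : iIndepFun ζ P) {K : ℝ}
    (hK : ∀ u v x, u ≤ v → P.real {ω | incr ζ u v ω = x} ≤ K / ((v - u : ℕ) + 1))
    {m N : ℕ} (hN : N ≤ m) (p : Fin 2 → ℤ) :
    ∫ ω, (crossCount (fun i => ζ i ω) (Finset.Ioc (m - N) m) (Finset.Ioc m (m + N)) p : ℝ) ^ 2 ∂P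
      ≤ 64 * K ^ 2 * N ^ 2 := by
  simp only [crossCount_blocks_eq hN]
  rw [integral_sq_sum_indicator]
  swap
  · rintro ⟨i, j⟩
    exact measurable_incr hm (show m - i ≤ m + 1 + j by omega) (measurableSet_singleton _)
  have hle : ∀ z ∈ Finset.range N ×ˢ Finset.range N, ∀ z' ∈ Finset.range N ×ˢ Finset.range N,
      P.real ({ω | incr ζ (m - z.1) (m + 1 + z.2) ω = -p} ∩
        {ω | incr ζ (m - z'.1) (m + 1 + z'.2) ω = -p}) ≤
      K ^ 2 * (pairWeight z.1 z'.1 * pairWeight z.2 z'.2) := by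
    intro z hz z' hz'
    simp only [Finset.mem_product, Finset.mem_range] at hz hz'
    exact measureReal_two_incr_le hm hi hK m (by omega) (by omega) _ _ _
  refine (Finset.sum_le_sum fun z hz => Finset.sum_le_sum (hle z hz)).trans ?_
  simp only [← Finset.mul_sum, Finset.sum_product, ← Finset.sum_mul]
  have h0 : 0 ≤ ∑ i ∈ Finset.range N, ∑ i' ∈ Finset.range N, pairWeight i i' :=
    Finset.sum_nonneg fun i _ => Finset.sum_nonneg fun i' _ => pairWeight_nonneg i i'
  have h1 := sum_pairWeight_le N
  have h2 := mul_le_mul h1 h1 h0 (by positivity)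
  calc _ = K ^ 2 * ((∑ i ∈ Finset.range N, ∑ i' ∈ Finset.range N, pairWeight i i') *
      ∑ i ∈ Finset.range N, ∑ i' ∈ Finset.range N, pairWeight i i') := by
        congr 1
    _ ≤ K ^ 2 * (8 * N * (8 * N)) := by gcongr
    _ = _ := by ring

/-- Only differences of positions enter, so the past before time `l` drops out; adjacent blocks
therefore have independent self-counts. -/
lemma measurable_selfCount_stepAlg (l r : ℕ) (p : Fin 2 → ℤ) :
    Measurable[stepAlg ζ (Set.Ico l r)]
      fun ω => (selfCount (fun i => ζ i ω) (Finset.Ioc l r) p : ℝ) := by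
  simp only [selfCount, crossCount_eq_sum]
  push_cast
  let _ := stepAlg ζ (Set.Ico l r)
  refine Finset.measurable_sum _ fun u hu => Finset.measurable_sum _ fun v hv => ?_
  rw [Finset.mem_Ioc] at hu hv
  refine Measurable.ite ?_ measurable_const measurable_const
  rcases le_total v u with h | h
  · exact measurable_incr_stepAlg h (Set.Ico_subset_Ico hv.1.le hu.2) (measurableSet_singleton p)
  · have := measurable_incr_stepAlg (ζ := ζ) h (Set.Ico_subset_Ico hu.1.le hv.2)
      (measurableSet_singleton (-p))
    convert this using 1
    ext ω
    simp only [Set.mem_ofPred_eq, Set.mem_preimage, Set.mem_singleton_iff, incr]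
    rw [← neg_sub, neg_eq_iff_eq_neg]

/-- Expanding `0 ≤ Var (X - 2Y)` bounds the covariance. The factor on `X` has to be below `2`, so
that doubling the interval multiplies the main term of the variance by less than `4`. -/
lemma variance_add_le {X Y : Ω → ℝ} (hX : MemLp X 2 P) (hY : MemLp Y 2 P) :
    Var[X + Y; P] ≤ 3 / 2 * Var[X; P] + 3 * Var[Y; P] := by
  have h := variance_nonneg (X - fun ω => 2 * Y ω) P
  rw [variance_sub hX (hY.const_mul 2), variance_const_mul, covariance_const_mul_right] at h
  rw [variance_add hX hY]
  linarith

lemma variance_selfCount_double_le (hm : ∀ i, Measurable (ζ i)) (hi : iIndepFun ζ P) {K : ℝ}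
    (hK : ∀ u v x, u ≤ v → P.real {ω | incr ζ u v ω = x} ≤ K / ((v - u : ℕ) + 1))
    (l N : ℕ) (p : Fin 2 → ℤ) :
    Var[fun ω => (selfCount (fun i => ζ i ω) (Finset.Ioc l (l + 2 * N)) p : ℝ); P] ≤
      3 / 2 * (Var[fun ω => (selfCount (fun i => ζ i ω) (Finset.Ioc l (l + N)) p : ℝ); P] +
        Var[fun ω => (selfCount (fun i => ζ i ω) (Finset.Ioc (l + N) (l + N + N)) p : ℝ); P]) +
      768 * K ^ 2 * N ^ 2 := by
  set I := Finset.Ioc l (l + N) with hI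
  set J := Finset.Ioc (l + N) (l + N + N) with hJ
  have hIJ : Finset.Ioc l (l + 2 * N) = I ∪ J := by
    rw [hI, hJ, Finset.Ioc_union_Ioc_eq_Ioc (by omega) (by omega)]
    congr 1; ring
  have hd : Disjoint I J := by
    rw [Finset.disjoint_left]; intro x; simp only [hI, hJ, Finset.mem_Ioc]; omega
  set X : Ω → ℝ := fun ω => (selfCount (fun i => ζ i ω) I p : ℝ)
  set Y : Ω → ℝ := fun ω => (selfCount (fun i => ζ i ω) J p : ℝ)
  set Q : Ω → ℝ := fun ω => (crossCount (fun i => ζ i ω) I J p : ℝ)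
  set R : Ω → ℝ := fun ω => (crossCount (fun i => ζ i ω) I J (-p) : ℝ)
  have hX : MemLp X 2 P := memLp_crossCount hm _ _ _
  have hY : MemLp Y 2 P := memLp_crossCount hm _ _ _
  have hQ : MemLp Q 2 P := memLp_crossCount hm _ _ _
  have hR : MemLp R 2 P := memLp_crossCount hm _ _ _
  have hdec : (fun ω => (selfCount (fun i => ζ i ω) (Finset.Ioc l (l + 2 * N)) p : ℝ)) =
      (X + Y) + (Q + R) := by
    funext ω
    simp only [hIJ, selfCount_union _ hd, crossCount_swap _ I J p, X, Y, Q, R, Pi.add_apply]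
    push_cast
    ring
  have hind : IndepFun X Y P := indepFun_of_stepAlg hm hi
    (S := Set.Ico l (l + N)) (T := Set.Ico (l + N) (l + N + N))
    (by rw [Set.disjoint_left]; intro x hx hx'; simp at hx hx'; omega)
    (measurable_selfCount_stepAlg _ _ p) (measurable_selfCount_stepAlg _ _ p)
  have hI' : I = Finset.Ioc (l + N - N) (l + N) := by rw [hI, Nat.add_sub_cancel]
  have hQ2 : ∫ ω, Q ω ^ 2 ∂P ≤ 64 * K ^ 2 * N ^ 2 := by
    simp only [Q, hI']
    exact integral_sq_crossCount_le hm hi hK (by omega) p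
  have hR2 : ∫ ω, R ω ^ 2 ∂P ≤ 64 * K ^ 2 * N ^ 2 := by
    simp only [R, hI']
    exact integral_sq_crossCount_le hm hi hK (by omega) (-p)
  have hQR : Var[Q + R; P] ≤ 256 * K ^ 2 * N ^ 2 := by
    refine (variance_le_expectation_sq (hQ.add hR).aestronglyMeasurable).trans ?_
    calc ∫ ω, ((Q + R) ^ 2) ω ∂P ≤ ∫ ω, (2 * Q ω ^ 2 + 2 * R ω ^ 2) ∂P := by
          refine integral_mono (hQ.add hR).integrable_sq
            ((hQ.integrable_sq.const_mul 2).add (hR.integrable_sq.const_mul 2)) fun ω => ?_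
          simp only [Pi.pow_apply, Pi.add_apply]
          nlinarith [sq_nonneg (Q ω - R ω)]
      _ = 2 * ∫ ω, Q ω ^ 2 ∂P + 2 * ∫ ω, R ω ^ 2 ∂P := by
          rw [integral_add (hQ.integrable_sq.const_mul 2) (hR.integrable_sq.const_mul 2),
            integral_const_mul, integral_const_mul]
      _ ≤ _ := by linarith
  rw [hdec]
  refine (variance_add_le (hX.add hY) (hQ.add hR)).trans ?_
  rw [hind.variance_add hX hY]
  linarith

lemma exists_variance_selfCount_le (hm : ∀ i, Measurable (ζ i)) (hi : iIndepFun ζ P) {K : ℝ}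
    (hK : ∀ u v x, u ≤ v → P.real {ω | incr ζ u v ω = x} ≤ K / ((v - u : ℕ) + 1))
    (q : ℕ) (p : Fin 2 → ℤ) :
    ∃ D : ℝ, ∀ k l : ℕ,
      Var[fun ω => (selfCount (fun i => ζ i ω) (Finset.Ioc l (l + q * 2 ^ k)) p : ℝ); P] ≤
        D * 4 ^ k := by
  -- The second entry covers `k = 0`, where the count is at most `q²`; the first absorbs the cross
  -- terms. The recursion closes exactly: `3/2 · 2D + D = 4D`.
  refine ⟨max (768 * K ^ 2 * q ^ 2) (q ^ 4), fun k => ?_⟩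
  set D : ℝ := max (768 * K ^ 2 * q ^ 2) (q ^ 4) with hD
  induction k with
  | zero =>
    intro l
    have hb : ∀ ω, (selfCount (fun i => ζ i ω) (Finset.Ioc l (l + q * 2 ^ 0)) p : ℝ) ≤ q ^ 2 := by
      intro ω
      have := crossCount_le (fun i => ζ i ω) (Finset.Ioc l (l + q * 2 ^ 0))
        (Finset.Ioc l (l + q * 2 ^ 0)) p
      simp only [pow_zero, mul_one, Nat.card_Ioc, Nat.add_sub_cancel_left, ← sq] at this
      simp only [pow_zero, mul_one]
      exact_mod_cast this
    refine (variance_le_expectation_sq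
      (measurable_natCast_crossCount hm _ _ p).aestronglyMeasurable).trans ?_
    calc _ ≤ ∫ _, ((q : ℝ) ^ 2) ^ 2 ∂P := by
          refine integral_mono (memLp_crossCount hm _ _ _).integrable_sq (integrable_const _)
            fun ω => ?_
          exact pow_le_pow_left₀ (Nat.cast_nonneg _) (hb ω) 2
      _ = (q : ℝ) ^ 4 := by simp; ring
      _ ≤ D * 4 ^ 0 := by rw [pow_zero, mul_one]; exact le_max_right _ _
  | succ k ih =>
    intro l
    have h := variance_selfCount_double_le hm hi hK l (q * 2 ^ k) p
    have e : l + 2 * (q * 2 ^ k) = l + q * 2 ^ (k + 1) := by ring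
    rw [e] at h
    refine h.trans ?_
    have h1 := ih l
    have h2 := ih (l + q * 2 ^ k)
    have h3 : 768 * K ^ 2 * q ^ 2 ≤ D := le_max_left _ _
    have h4 : (768 * K ^ 2 * q ^ 2) * 4 ^ k ≤ D * 4 ^ k := by gcongr
    have h5 : 768 * K ^ 2 * ((q * 2 ^ k : ℕ) : ℝ) ^ 2 = (768 * K ^ 2 * q ^ 2) * 4 ^ k := by
      push_cast
      rw [mul_pow, ← pow_mul, mul_comm k 2, pow_mul]
      norm_num
      ring
    rw [h5, pow_succ (4 : ℝ) k]
    linarith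

/-- By monotone convergence `∑ Y_k²` has finite expectation, hence is almost surely finite and its
terms tend to zero. -/
lemma ae_tendsto_zero_of_summable_integral_sq {Y : ℕ → Ω → ℝ} (hY : ∀ k, Measurable (Y k))
    (hi : ∀ k, Integrable (fun ω => Y k ω ^ 2) P) {b : ℕ → ℝ}
    (hb : ∀ k, ∫ ω, Y k ω ^ 2 ∂P ≤ b k) (hs : Summable b) :
    ∀ᵐ ω ∂P, Tendsto (fun k => Y k ω) atTop (𝓝 0) := by
  have hfin : ∫⁻ ω, ∑' k, ENNReal.ofReal (Y k ω ^ 2) ∂P ≠ ⊤ := by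
    rw [lintegral_tsum fun k => ((hY k).pow_const 2).ennreal_ofReal.aemeasurable]
    refine ne_top_of_le_ne_top hs.tsum_ofReal_ne_top (ENNReal.tsum_le_tsum fun k => ?_)
    rw [← ofReal_integral_eq_lintegral_ofReal (hi k)
      (Eventually.of_forall fun ω => sq_nonneg _)]
    exact ENNReal.ofReal_le_ofReal (hb k)
  filter_upwards [ae_lt_top (Measurable.tsum fun k => ((hY k).pow_const 2).ennreal_ofReal) hfin]
    with ω hω
  have h1 := ENNReal.tendsto_cofinite_zero_of_tsum_ne_top hω.ne
  rw [Nat.cofinite_eq_atTop] at h1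
  have h2 := (ENNReal.tendsto_toReal ENNReal.zero_ne_top).comp h1
  simp only [Function.comp_def, ENNReal.toReal_ofReal (sq_nonneg _), ENNReal.toReal_zero] at h2
  have h3 := h2.sqrt
  simp only [Real.sqrt_sq_eq_abs, Real.sqrt_zero] at h3
  exact (tendsto_zero_iff_abs_tendsto_zero _).2 h3

/-- Strong law along dyadic scales, for the centered self-intersection counts. -/
lemma ae_tendsto_centered_selfCount (hm : ∀ i, Measurable (ζ i)) (hi : iIndepFun ζ P) {K : ℝ}
    (hK : ∀ u v x, u ≤ v → P.real {ω | incr ζ u v ω = x} ≤ K / ((v - u : ℕ) + 1))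
    (i q : ℕ) (p : Fin 2 → ℤ) :
    ∀ᵐ ω ∂P, Tendsto (fun k : ℕ =>
      ((selfCount (fun j => ζ j ω) (Finset.Ioc (i * 2 ^ k) (i * 2 ^ k + q * 2 ^ k)) p : ℝ) -
        ∫ ω', (selfCount (fun j => ζ j ω') (Finset.Ioc (i * 2 ^ k) (i * 2 ^ k + q * 2 ^ k)) p : ℝ)
          ∂P) / (2 ^ k * k)) atTop (𝓝 0) := by
  obtain ⟨D, hD⟩ := exists_variance_selfCount_le hm hi hK q p
  have hsum : Summable fun k : ℕ => D * (1 / (k : ℝ) ^ 2) :=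
    (Real.summable_one_div_nat_pow.2 one_lt_two).mul_left D
  refine ae_tendsto_zero_of_summable_integral_sq (b := fun k => D * (1 / (k : ℝ) ^ 2)) ?_ ?_ ?_ hsum
  · intro k
    exact ((measurable_natCast_selfCount hm _ p).sub_const _).div_const _
  · intro k
    simp only [div_pow]
    exact ((memLp_crossCount hm _ _ _).sub (memLp_const _)).integrable_sq.div_const _
  · intro k
    simp only [div_pow]
    rw [integral_div, ← variance_eq_integral
      (measurable_natCast_selfCount hm _ p).aemeasurable]
    -- At `k = 0` both sides vanish because division by zero is zero.
    rcases Nat.eq_zero_or_pos k with rfl | hk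
    · simp
    · have hk' : (0 : ℝ) < k := by exact_mod_cast hk
      rw [div_le_iff₀ (by positivity)]
      refine (hD k _).trans (le_of_eq ?_)
      rw [mul_pow, ← pow_mul, mul_comm k 2, pow_mul]
      field_simp
      norm_num

end SecondMoment

/-! ### Characters of `ℤ²`, characteristic functions and a concentration inequality. -/

/-- The pairing of a frequency with a lattice point. -/
def freqDot (t : ℝ × ℝ) (x : Fin 2 → ℤ) : ℝ := t.1 * x 0 + t.2 * x 1

/-- The character `x ↦ exp (i ⟨t, x⟩)` of `ℤ²`. -/
noncomputable def latticeChar (t : ℝ × ℝ) (x : Fin 2 → ℤ) : ℂ :=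
  Complex.exp (Complex.I * (freqDot t x : ℂ))

/-- The characteristic function of a random vector with values in `ℤ²`. -/
noncomputable def latticeCF {Ω : Type*} [MeasurableSpace Ω] (P : Measure Ω)
    (X : Ω → (Fin 2 → ℤ)) (t : ℝ × ℝ) : ℂ := ∫ ω, latticeChar t (X ω) ∂P

/-- The quadratic form with matrix `!![a, b; b, c]`. -/
def quadForm (a b c : ℝ) (t : ℝ × ℝ) : ℝ := a * t.1 ^ 2 + 2 * b * (t.1 * t.2) + c * t.2 ^ 2

section Character

lemma norm_latticeChar (t : ℝ × ℝ) (x : Fin 2 → ℤ) : ‖latticeChar t x‖ = 1 :=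
  Complex.norm_exp_I_mul_ofReal _

lemma latticeChar_add (t : ℝ × ℝ) (x y : Fin 2 → ℤ) :
    latticeChar t (x + y) = latticeChar t x * latticeChar t y := by
  rw [latticeChar, latticeChar, latticeChar, ← Complex.exp_add]
  congr 1
  simp only [freqDot, Pi.add_apply]
  push_cast
  ring

lemma latticeChar_zero_right (t : ℝ × ℝ) : latticeChar t 0 = 1 := by
  simp [latticeChar, freqDot]

lemma latticeChar_sub_left (s t : ℝ × ℝ) (x : Fin 2 → ℤ) :
    latticeChar (s - t) x = latticeChar s x * starRingEnd ℂ (latticeChar t x) := by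
  rw [latticeChar, latticeChar, latticeChar, ← Complex.exp_conj, ← Complex.exp_add]
  congr 1
  simp only [freqDot, Prod.fst_sub, Prod.snd_sub, map_mul, Complex.conj_I, Complex.conj_ofReal]
  push_cast
  ring

@[fun_prop]
lemma continuous_freqDot (x : Fin 2 → ℤ) : Continuous fun t => freqDot t x := by
  unfold freqDot; fun_prop

@[fun_prop]
lemma continuous_latticeChar (x : Fin 2 → ℤ) : Continuous fun t => latticeChar t x := by
  unfold latticeChar; fun_prop

lemma measurable_latticeChar_uncurry :
    Measurable fun z : (ℝ × ℝ) × (Fin 2 → ℤ) => latticeChar z.1 z.2 :=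
  measurable_from_prod_countable_left fun x => (continuous_latticeChar x).measurable

variable {Ω : Type*} [MeasurableSpace Ω] {P : Measure Ω} [IsProbabilityMeasure P]

lemma measurable_latticeChar_comp {X : Ω → (Fin 2 → ℤ)} (hX : Measurable X) (t : ℝ × ℝ) :
    Measurable fun ω => latticeChar t (X ω) :=
  (measurable_of_countable (latticeChar t)).comp hX

lemma integrable_latticeChar_comp {X : Ω → (Fin 2 → ℤ)} (hX : Measurable X) (t : ℝ × ℝ) :
    Integrable (fun ω => latticeChar t (X ω)) P :=
  Integrable.of_bound (measurable_latticeChar_comp hX t).aestronglyMeasurable 1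
    (Eventually.of_forall fun _ => (norm_latticeChar _ _).le)

lemma norm_latticeCF_le (X : Ω → (Fin 2 → ℤ)) (t : ℝ × ℝ) : ‖latticeCF P X t‖ ≤ 1 := by
  refine (norm_integral_le_integral_norm _).trans ?_
  simp [norm_latticeChar]

lemma continuous_latticeCF {X : Ω → (Fin 2 → ℤ)} (hX : Measurable X) :
    Continuous (latticeCF P X) :=
  continuous_of_dominated (fun t => (measurable_latticeChar_comp hX t).aestronglyMeasurable)
    (bound := fun _ => 1) (fun _ => Eventually.of_forall fun _ => (norm_latticeChar _ _).le)
    (integrable_const _) (Eventually.of_forall fun _ => continuous_latticeChar _)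

lemma latticeCF_add {X Y : Ω → (Fin 2 → ℤ)} (hX : Measurable X) (hY : Measurable Y)
    (h : IndepFun X Y P) (t : ℝ × ℝ) :
    latticeCF P (fun ω => X ω + Y ω) t = latticeCF P X t * latticeCF P Y t := by
  simp only [latticeCF, latticeChar_add]
  exact (h.comp (measurable_of_countable (latticeChar t))
    (measurable_of_countable (latticeChar t))).integral_fun_mul_eq_mul_integral
      (measurable_latticeChar_comp hX t).aestronglyMeasurable
      (measurable_latticeChar_comp hY t).aestronglyMeasurable

lemma latticeCF_incr {ζ : ℕ → Ω → (Fin 2 → ℤ)} (hm : ∀ i, Measurable (ζ i))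
    (hi : iIndepFun ζ P) (hid : ∀ i, IdentDistrib (ζ i) (ζ 0) P P) {u v : ℕ} (h : u ≤ v)
    (t : ℝ × ℝ) : latticeCF P (incr ζ u v) t = latticeCF P (ζ 0) t ^ (v - u) := by
  induction v, h using Nat.le_induction with
  | base => simp [latticeCF, incr, latticeChar_zero_right]
  | succ v h ih =>
    have e : incr ζ u (v + 1) = fun ω => incr ζ u v ω + ζ v ω := by
      funext ω
      rw [incr_eq_sum h, incr_eq_sum (h.trans (Nat.le_succ v)), Finset.sum_Ico_succ_top h]
    have e' : ζ v = incr ζ v (v + 1) := by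
      funext ω
      rw [incr_eq_sum (Nat.le_succ v)]; simp
    have hind : IndepFun (incr ζ u v) (ζ v) P := by
      rw [e']
      refine indepFun_of_stepAlg hm hi ?_ (measurable_incr_stepAlg h subset_rfl)
        (measurable_incr_stepAlg (Nat.le_succ v) subset_rfl)
      rw [Set.disjoint_left]; intro x hx hx'; simp at hx hx'; omega
    have hid' : latticeCF P (ζ v) t = latticeCF P (ζ 0) t :=
      ((hid v).comp (measurable_of_countable (latticeChar t))).integral_eq
    rw [e, latticeCF_add (measurable_incr hm h) (hm v) hind, ih, hid', Nat.succ_sub h, pow_succ]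

/-- A concentration inequality: the atoms of `X` are controlled by an average of its
characteristic function over differences of frequencies. -/
lemma measureReal_atom_le {X : Ω → (Fin 2 → ℤ)} (hX : Measurable X) (x : Fin 2 → ℤ)
    (μ : Measure (ℝ × ℝ)) [IsFiniteMeasure μ] :
    μ.real Set.univ ^ 2 * P.real {ω | X ω = x} ≤
      ∫ z, ‖latticeCF P X (z.1 - z.2)‖ ∂(μ.prod μ) := by
  -- The nonnegative function `‖g‖²` equals the squared mass of `μ` on the event `X = x`, and its
  -- mean is the double integral of the characteristic function, up to phases.
  set g : Ω → ℂ := fun ω => ∫ s, latticeChar s (X ω + -x) ∂μ with hg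
  have hgsq : ∀ ω, ((‖g ω‖ ^ 2 : ℝ) : ℂ) =
      ∫ z, latticeChar (z.1 - z.2) (X ω + -x) ∂(μ.prod μ) := by
    intro ω
    simp only [latticeChar_sub_left]
    rw [integral_prod_mul (fun s => latticeChar s (X ω + -x))
      (fun s => starRingEnd ℂ (latticeChar s (X ω + -x))), integral_conj, Complex.mul_conj,
      Complex.normSq_eq_norm_sq]
  have hmeas : Measurable fun w : Ω × ((ℝ × ℝ) × (ℝ × ℝ)) =>
      latticeChar (w.2.1 - w.2.2) (X w.1 + -x) :=
    measurable_latticeChar_uncurry.comp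
      ((measurable_snd.fst.sub measurable_snd.snd).prodMk
        ((hX.comp measurable_fst).add_const (-x)))
  have hint : Integrable (Function.uncurry fun (ω : Ω) (z : (ℝ × ℝ) × (ℝ × ℝ)) =>
      latticeChar (z.1 - z.2) (X ω + -x)) (P.prod (μ.prod μ)) :=
    Integrable.of_bound hmeas.aestronglyMeasurable 1
      (Eventually.of_forall fun _ => (norm_latticeChar _ _).le)
  have hgm : Measurable fun ω => ‖g ω‖ ^ 2 := by
    have h1 : Measurable g :=
      (measurable_of_countable fun y : Fin 2 → ℤ => ∫ s, latticeChar s (y + -x) ∂μ).comp hX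
    exact h1.norm.pow_const 2
  have hgb : ∀ ω, ‖g ω‖ ≤ μ.real Set.univ := by
    intro ω
    refine (norm_integral_le_integral_norm _).trans ?_
    simp [norm_latticeChar]
  have hgi : Integrable (fun ω => ‖g ω‖ ^ 2) P :=
    Integrable.of_bound hgm.aestronglyMeasurable (μ.real Set.univ ^ 2)
      (Eventually.of_forall fun ω => by
        rw [Real.norm_of_nonneg (by positivity)]
        exact pow_le_pow_left₀ (norm_nonneg _) (hgb ω) 2)
  have hset : MeasurableSet {ω | X ω = x} := hX (measurableSet_singleton x)
  calc μ.real Set.univ ^ 2 * P.real {ω | X ω = x}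
      = ∫ ω, {ω | X ω = x}.indicator (fun _ => μ.real Set.univ ^ 2) ω ∂P := by
        rw [integral_indicator_const _ hset, smul_eq_mul, mul_comm]
    _ ≤ ∫ ω, ‖g ω‖ ^ 2 ∂P := by
        refine integral_mono ((integrable_const _).indicator hset) hgi fun ω => ?_
        by_cases hω : X ω = x
        · have : g ω = (μ.real Set.univ : ℂ) := by
            simp [hg, hω, latticeChar_zero_right]
          simp [Set.indicator_of_mem, hω, this]
        · rw [Set.indicator_of_notMem (show ω ∉ {ω | X ω = x} from hω)]; positivity
    _ = ‖∫ ω, ((‖g ω‖ ^ 2 : ℝ) : ℂ) ∂P‖ := by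
        rw [integral_complex_ofReal, Complex.norm_real, Real.norm_of_nonneg]
        exact integral_nonneg fun ω => by positivity
    _ = ‖∫ z, ∫ ω, latticeChar (z.1 - z.2) (X ω + -x) ∂P ∂(μ.prod μ)‖ := by
        simp only [hgsq]
        rw [integral_integral_swap hint]
    _ ≤ ∫ z, ‖latticeCF P X (z.1 - z.2)‖ ∂(μ.prod μ) := by
        refine (norm_integral_le_integral_norm _).trans (le_of_eq ?_)
        congr 1
        funext z
        simp only [latticeChar_add]
        rw [integral_mul_const, norm_mul, norm_latticeChar, mul_one]
        rfl

end Character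

/-! ### Second-order expansion of the characteristic function at the origin. -/

section Expansion

lemma norm_expRemainder_le_cube {x : ℝ} (hx : |x| ≤ 1) :
    ‖Complex.exp (Complex.I * x) - 1 - Complex.I * x + (x : ℂ) ^ 2 / 2‖ ≤ |x| ^ 3 := by
  have h := Complex.exp_bound (x := Complex.I * x) (by simpa using hx) (n := 3) (by norm_num)
  have e : ∑ m ∈ Finset.range 3, (Complex.I * (x : ℂ)) ^ m / (m.factorial : ℂ) =
      1 + Complex.I * x - (x : ℂ) ^ 2 / 2 := by
    simp [Finset.sum_range_succ, Nat.factorial, mul_pow]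
    ring
  rw [e, norm_mul, Complex.norm_I, one_mul, Complex.norm_real, Real.norm_eq_abs] at h
  have e2 : Complex.exp (Complex.I * x) - 1 - Complex.I * x + (x : ℂ) ^ 2 / 2 =
    Complex.exp (Complex.I * x) - (1 + Complex.I * x - (x : ℂ) ^ 2 / 2) := by ring
  rw [e2]
  refine h.trans ?_
  norm_num [Nat.factorial]
  nlinarith [pow_nonneg (abs_nonneg x) 3]

/-- This quadratic bound dominates the remainder using second moments only; the cubic one supplies
the pointwise limit in the dominated convergence argument. -/
lemma norm_expRemainder_le_sq (x : ℝ) :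
    ‖Complex.exp (Complex.I * x) - 1 - Complex.I * x + (x : ℂ) ^ 2 / 2‖ ≤ 3 * x ^ 2 := by
  rcases le_total |x| 1 with hx | hx
  · refine (norm_expRemainder_le_cube hx).trans ?_
    rw [← sq_abs]
    nlinarith [pow_nonneg (abs_nonneg x) 2]
  · have h1 : ‖Complex.exp (Complex.I * x) - 1‖ ≤ |x| := Real.norm_exp_I_mul_ofReal_sub_one_le
    have h2 : ‖Complex.I * (x : ℂ)‖ = |x| := by simp
    have h3 : ‖(x : ℂ) ^ 2 / 2‖ = |x| ^ 2 / 2 := by simp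
    refine (norm_add_le _ _).trans ?_
    refine (add_le_add_left (norm_sub_le _ _) _).trans ?_
    rw [h2, h3]
    nlinarith [sq_abs x]

/-- The smallest eigenvalue is at least determinant over trace. By Cayley–Hamilton, `(a + c) q(t) -
(ac - b²)|t|²` is the squared length of the image of `t` under the matrix. -/
lemma quadForm_lower {a b c : ℝ} (ha : 0 < a) (hd : 0 < a * c - b ^ 2) (t : ℝ × ℝ) :
    (a * c - b ^ 2) / (a + c) * (t.1 ^ 2 + t.2 ^ 2) ≤ quadForm a b c t := by
  have hc : 0 < c := by
    by_contra h
    nlinarith [sq_nonneg b]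
  rw [div_mul_eq_mul_div, div_le_iff₀ (by positivity), quadForm]
  nlinarith [sq_nonneg (a * t.1 + b * t.2), sq_nonneg (b * t.1 + c * t.2)]

lemma abs_freqDot_le (t : ℝ × ℝ) (x : Fin 2 → ℤ) :
    |freqDot t x| ≤ ‖t‖ * (|(x 0 : ℝ)| + |(x 1 : ℝ)|) := by
  have h1 : |t.1| ≤ ‖t‖ := norm_fst_le t
  have h2 : |t.2| ≤ ‖t‖ := norm_snd_le t
  calc |freqDot t x| ≤ |t.1 * x 0| + |t.2 * x 1| := abs_add_le _ _
    _ = |t.1| * |(x 0 : ℝ)| + |t.2| * |(x 1 : ℝ)| := by rw [abs_mul, abs_mul]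
    _ ≤ ‖t‖ * |(x 0 : ℝ)| + ‖t‖ * |(x 1 : ℝ)| := by gcongr
    _ = _ := by ring

variable {Ω : Type*} [MeasurableSpace Ω] {P : Measure Ω} [IsProbabilityMeasure P]

lemma tendsto_integral_expRemainder {X : Ω → (Fin 2 → ℤ)} (hX : Measurable X)
    (hL2 : ∀ j, MemLp (fun ω => (X ω j : ℝ)) 2 P) :
    Tendsto (fun t : ℝ × ℝ => (∫ ω, ‖Complex.exp (Complex.I * (freqDot t (X ω) : ℂ)) - 1 -
      Complex.I * (freqDot t (X ω) : ℂ) + (freqDot t (X ω) : ℂ) ^ 2 / 2‖ / ‖t‖ ^ 2 ∂P))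
      (𝓝[≠] 0) (𝓝 0) := by
  have hz : (0 : ℝ) = ∫ _, (0 : ℝ) ∂P := by simp
  rw [hz]
  refine tendsto_integral_filter_of_dominated_convergence
    (fun ω => 3 * (|(X ω 0 : ℝ)| + |(X ω 1 : ℝ)|) ^ 2) ?_ ?_ ?_ ?_
  · refine Eventually.of_forall fun t => Measurable.aestronglyMeasurable ?_
    exact (measurable_of_countable fun x : Fin 2 → ℤ =>
      ‖Complex.exp (Complex.I * (freqDot t x : ℂ)) - 1 -
      Complex.I * (freqDot t x : ℂ) + (freqDot t x : ℂ) ^ 2 / 2‖ / ‖t‖ ^ 2).comp hX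
  · filter_upwards [self_mem_nhdsWithin] with t ht
    refine Eventually.of_forall fun ω => ?_
    have ht' : 0 < ‖t‖ := norm_pos_iff.2 ht
    rw [Real.norm_of_nonneg (by positivity), div_le_iff₀ (by positivity)]
    refine (norm_expRemainder_le_sq _).trans ?_
    have := pow_le_pow_left₀ (abs_nonneg _) (abs_freqDot_le t (X ω)) 2
    rw [sq_abs, mul_pow] at this
    linarith
  · exact (((hL2 0).norm.add (hL2 1).norm).integrable_sq).const_mul 3
  · refine Eventually.of_forall fun ω => ?_
    set M := |(X ω 0 : ℝ)| + |(X ω 1 : ℝ)| with hM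
    have hM0 : 0 ≤ M := by positivity
    have hlim : Tendsto (fun t : ℝ × ℝ => ‖t‖ * M ^ 3) (𝓝[≠] 0) (𝓝 0) := by
      have : Tendsto (fun t : ℝ × ℝ => ‖t‖ * M ^ 3) (𝓝 0) (𝓝 (‖(0 : ℝ × ℝ)‖ * M ^ 3)) :=
        (by fun_prop : Continuous fun t : ℝ × ℝ => ‖t‖ * M ^ 3).tendsto 0
      rw [norm_zero, zero_mul] at this
      exact this.mono_left nhdsWithin_le_nhds
    have hsmall : ∀ᶠ t : ℝ × ℝ in 𝓝[≠] 0, ‖t‖ * M < 1 := by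
      have : Tendsto (fun t : ℝ × ℝ => ‖t‖ * M) (𝓝 0) (𝓝 (‖(0 : ℝ × ℝ)‖ * M)) :=
        (by fun_prop : Continuous fun t : ℝ × ℝ => ‖t‖ * M).tendsto 0
      rw [norm_zero, zero_mul] at this
      exact nhdsWithin_le_nhds (this.eventually (gt_mem_nhds one_pos))
    refine squeeze_zero' (Eventually.of_forall fun t => by positivity) ?_ hlim
    filter_upwards [self_mem_nhdsWithin, hsmall] with t ht hs
    have ht' : 0 < ‖t‖ := norm_pos_iff.2 ht
    rw [div_le_iff₀ (by positivity)]
    have h1 := abs_freqDot_le t (X ω)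
    refine (norm_expRemainder_le_cube (h1.trans hs.le)).trans ?_
    calc |freqDot t (X ω)| ^ 3 ≤ (‖t‖ * M) ^ 3 := pow_le_pow_left₀ (abs_nonneg _) h1 3
      _ = _ := by ring

/-- Second-order expansion of the characteristic function of a planar walk step at `0`. -/
lemma exists_quadForm_expansion {ζ : ℕ → Ω → (Fin 2 → ℤ)} (hζ : IsPlanarWalkSteps P ζ) :
    ∃ a b c : ℝ, 0 < a ∧ 0 < a * c - b ^ 2 ∧ (covMatrix P (ζ 0)).det = a * c - b ^ 2 ∧
      ∀ ε > 0, ∃ δ > 0, ∀ t : ℝ × ℝ, ‖t‖ < δ →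
        ‖latticeCF P (ζ 0) t - 1 + ((quadForm a b c t / 2 : ℝ) : ℂ)‖ ≤ ε * quadForm a b c t := by
  have hm := hζ.measurable 0
  have hL := hζ.memLp_two
  set X : Ω → (Fin 2 → ℤ) := ζ 0
  set a := ∫ ω, (X ω 0 : ℝ) * X ω 0 ∂P with ha
  set b := ∫ ω, (X ω 0 : ℝ) * X ω 1 ∂P with hb
  set c := ∫ ω, (X ω 1 : ℝ) * X ω 1 ∂P with hc
  have hi : ∀ i j, Integrable (fun ω => (X ω i : ℝ) * X ω j) P := fun i j =>
    (hL i).integrable_mul (hL j)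
  have hi1 : ∀ i, Integrable (fun ω => (X ω i : ℝ)) P := fun i =>
    (hL i).integrable one_le_two
  have hcov : ∀ i j, covMatrix P X i j = ∫ ω, (X ω i : ℝ) * X ω j ∂P := by
    intro i j
    rw [covMatrix, Matrix.of_apply, covariance_eq_sub (hL i) (hL j), hζ.mean_zero i, zero_mul,
      sub_zero]
    rfl
  have hdet : (covMatrix P X).det = a * c - b ^ 2 := by
    have hsymm : ∫ ω, (X ω 1 : ℝ) * X ω 0 ∂P = b :=
      integral_congr_ae (Eventually.of_forall fun ω => mul_comm _ _)
    rw [Matrix.det_fin_two, hcov, hcov, hcov, hcov, hsymm, sq]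
  have hsq : ∀ t : ℝ × ℝ, Integrable (fun ω => freqDot t (X ω) ^ 2) P ∧
      ∫ ω, freqDot t (X ω) ^ 2 ∂P = quadForm a b c t := by
    intro t
    have e : (fun ω => freqDot t (X ω) ^ 2) = fun ω => t.1 ^ 2 * ((X ω 0 : ℝ) * X ω 0) +
        2 * (t.1 * t.2) * ((X ω 0 : ℝ) * X ω 1) + t.2 ^ 2 * ((X ω 1 : ℝ) * X ω 1) := by
      funext ω; rw [freqDot]; ring
    have i1 := (hi 0 0).const_mul (t.1 ^ 2)
    have i2 := (hi 0 1).const_mul (2 * (t.1 * t.2))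
    have i3 := (hi 1 1).const_mul (t.2 ^ 2)
    have i12 : Integrable (fun ω => t.1 ^ 2 * ((X ω 0 : ℝ) * X ω 0) +
        2 * (t.1 * t.2) * ((X ω 0 : ℝ) * X ω 1)) P := i1.add i2
    rw [e]
    refine ⟨i12.add i3, ?_⟩
    rw [integral_add i12 i3, integral_add i1 i2, integral_const_mul, integral_const_mul,
      integral_const_mul, quadForm, ← ha, ← hb, ← hc]
    ring
  have hq0 : ∀ t, 0 ≤ quadForm a b c t := fun t => by
    rw [← (hsq t).2]; exact integral_nonneg fun ω => sq_nonneg _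
  have hne : a * c - b ^ 2 ≠ 0 := hdet ▸ hζ.cov_nonsingular
  have ha0 : 0 ≤ a := by simpa [quadForm] using hq0 (1, 0)
  have hapos : 0 < a := by
    refine lt_of_le_of_ne ha0 fun h => ?_
    -- If `a = 0`, the form takes the value `-4b² < 0` at this vector.
    have h1 := hq0 (-(c + 1), 2 * b)
    simp only [quadForm, ← h] at h1 hne
    have : 0 < b ^ 2 := by
      rw [zero_mul, zero_sub, neg_ne_zero] at hne
      exact lt_of_le_of_ne (sq_nonneg b) (Ne.symm hne)
    nlinarith
  have hdpos : 0 < a * c - b ^ 2 := by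
    refine lt_of_le_of_ne ?_ (Ne.symm hne)
    -- The form takes the value `a (ac - b²)` here.
    have h1 := hq0 (b, -a)
    simp only [quadForm] at h1
    by_contra h
    push Not at h
    nlinarith
  refine ⟨a, b, c, hapos, hdpos, hdet, fun ε hε => ?_⟩
  have hcpos : 0 < c := by
    by_contra h
    nlinarith [sq_nonneg b]
  set κ := (a * c - b ^ 2) / (a + c) with hκ
  have hκ0 : 0 < κ := by positivity
  have hnorm : ∀ t : ℝ × ℝ, κ * ‖t‖ ^ 2 ≤ quadForm a b c t := by
    intro t
    refine le_trans ?_ (quadForm_lower hapos hdpos t)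
    rw [← hκ]
    gcongr
    rw [Prod.norm_def, Real.norm_eq_abs, Real.norm_eq_abs]
    rcases max_choice |t.1| |t.2| with h | h <;> rw [h, sq_abs] <;>
      nlinarith [sq_nonneg t.1, sq_nonneg t.2]
  have hev := (tendsto_integral_expRemainder hm hL).eventually
    (gt_mem_nhds (show (0 : ℝ) < ε * κ by positivity))
  rw [eventually_nhdsWithin_iff, Metric.eventually_nhds_iff] at hev
  obtain ⟨δ, hδ, hball⟩ := hev
  refine ⟨δ, hδ, fun t ht => ?_⟩
  have hfd : Integrable (fun ω => (freqDot t (X ω) : ℂ)) P ∧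
      ∫ ω, (freqDot t (X ω) : ℂ) ∂P = 0 := by
    have i1 := (hi1 0).const_mul t.1
    have i2 := (hi1 1).const_mul t.2
    refine ⟨(i1.add i2).ofReal, ?_⟩
    rw [integral_complex_ofReal]
    simp only [freqDot]
    rw [integral_add i1 i2, integral_const_mul, integral_const_mul, hζ.mean_zero 0,
      hζ.mean_zero 1]
    simp
  have hexp : latticeCF P X t - 1 + ((quadForm a b c t / 2 : ℝ) : ℂ) =
      ∫ ω, (Complex.exp (Complex.I * (freqDot t (X ω) : ℂ)) - 1 -
        Complex.I * (freqDot t (X ω) : ℂ) + (freqDot t (X ω) : ℂ) ^ 2 / 2) ∂P := by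
    have j1 : Integrable (fun ω => Complex.exp (Complex.I * (freqDot t (X ω) : ℂ))) P :=
      integrable_latticeChar_comp hm t
    have j2 : Integrable (fun _ : Ω => (1 : ℂ)) P := integrable_const _
    have j3 : Integrable (fun ω => Complex.I * (freqDot t (X ω) : ℂ)) P := hfd.1.const_mul _
    have j4 : Integrable (fun ω => (freqDot t (X ω) : ℂ) ^ 2 / 2) P := by
      have := ((hsq t).1.ofReal (𝕜 := ℂ)).div_const 2
      simpa using this
    have j12 : Integrable (fun ω => Complex.exp (Complex.I * (freqDot t (X ω) : ℂ)) - 1) P :=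
      j1.sub j2
    have j123 : Integrable (fun ω => Complex.exp (Complex.I * (freqDot t (X ω) : ℂ)) - 1 -
        Complex.I * (freqDot t (X ω) : ℂ)) P := j12.sub j3
    rw [integral_add j123 j4, integral_sub j12 j3, integral_sub j1 j2,
      integral_const_mul, hfd.2, mul_zero, sub_zero, integral_div]
    have : ∫ ω, (freqDot t (X ω) : ℂ) ^ 2 ∂P = (quadForm a b c t : ℂ) := by
      rw [← (hsq t).2, ← integral_complex_ofReal]
      simp
    rw [this]
    simp [latticeCF, latticeChar]
  rw [hexp]
  by_cases ht0 : t = 0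
  · subst ht0
    simp [freqDot, quadForm]
  · have h1 := hball (by simpa using ht) ht0
    have ht' : 0 < ‖t‖ := norm_pos_iff.2 ht0
    rw [integral_div, div_lt_iff₀ (by positivity)] at h1
    refine (norm_integral_le_integral_norm _).trans (h1.le.trans ?_)
    rw [mul_assoc]
    exact mul_le_mul_of_nonneg_left (hnorm t) hε.le

end Expansion

/-! ### Uniform decay of the atoms of the increments. -/

section SupBound

lemma integral_gaussian_prod {β : ℝ} (hβ : 0 < β) :
    Integrable (fun t : ℝ × ℝ => Real.exp (-β * (t.1 ^ 2 + t.2 ^ 2))) ∧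
    ∫ t : ℝ × ℝ, Real.exp (-β * (t.1 ^ 2 + t.2 ^ 2)) = Real.pi / β := by
  have e : (fun t : ℝ × ℝ => Real.exp (-β * (t.1 ^ 2 + t.2 ^ 2))) =
      fun t => Real.exp (-β * t.1 ^ 2) * Real.exp (-β * t.2 ^ 2) := by
    funext t; rw [← Real.exp_add]; ring_nf
  rw [e]
  refine ⟨(integrable_exp_neg_mul_sq hβ).mul_prod (integrable_exp_neg_mul_sq hβ), ?_⟩
  rw [Measure.volume_eq_prod, integral_prod_mul (fun x : ℝ => Real.exp (-β * x ^ 2))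
    (fun x : ℝ => Real.exp (-β * x ^ 2)), integral_gaussian,
    Real.mul_self_sqrt (by positivity)]

variable {Ω : Type*} [MeasurableSpace Ω] {P : Measure Ω} [IsProbabilityMeasure P]

/-- The atoms of the increments of a planar walk decay like the inverse of the time. -/
lemma exists_atom_bound {ζ : ℕ → Ω → (Fin 2 → ℤ)} (hζ : IsPlanarWalkSteps P ζ) :
    ∃ K : ℝ, ∀ u v x, u ≤ v → P.real {ω | incr ζ u v ω = x} ≤ K / ((v - u : ℕ) + 1) := by
  obtain ⟨a, b, c, ha, hd, -, hexp⟩ := exists_quadForm_expansion hζ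
  obtain ⟨δ₀, hδ₀, hexp⟩ := hexp (1 / 4) (by norm_num)
  have hcpos : 0 < c := by
    by_contra h
    nlinarith [sq_nonneg b]
  set κ := (a * c - b ^ 2) / (a + c) with hκ
  have hκ0 : 0 < κ := by positivity
  have hqc : Continuous (quadForm a b c) := by unfold quadForm; fun_prop
  have hq0 : Tendsto (quadForm a b c) (𝓝 0) (𝓝 0) := by
    have := hqc.tendsto 0
    simpa [quadForm] using this
  obtain ⟨δ₁, hδ₁, hq1⟩ := Metric.eventually_nhds_iff.1 (hq0.eventually (gt_mem_nhds two_pos))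
  set δ := min δ₀ δ₁ / 2 with hδ
  have hδpos : 0 < δ := by positivity
  have hdecay : ∀ t : ℝ × ℝ, ‖t‖ ≤ δ →
      ‖latticeCF P (ζ 0) t‖ ≤ Real.exp (-(κ / 4) * (t.1 ^ 2 + t.2 ^ 2)) := by
    intro t ht
    have hlt : ‖t‖ < min δ₀ δ₁ := ht.trans_lt (by rw [hδ]; linarith [lt_min hδ₀ hδ₁])
    have h1 := hexp t (hlt.trans_le (min_le_left _ _))
    have h2 : quadForm a b c t < 2 := hq1 (by simpa using hlt.trans_le (min_le_right _ _))
    have h3 := quadForm_lower ha hd t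
    rw [← hκ] at h3
    have h4 : latticeCF P (ζ 0) t = (latticeCF P (ζ 0) t - 1 + ((quadForm a b c t / 2 : ℝ) : ℂ)) +
        ((1 - quadForm a b c t / 2 : ℝ) : ℂ) := by push_cast; ring
    have h5 : ‖((1 - quadForm a b c t / 2 : ℝ) : ℂ)‖ = 1 - quadForm a b c t / 2 := by
      rw [Complex.norm_real, Real.norm_of_nonneg (by linarith)]
    -- Half of the quadratic decay pays for the expansion error, taken with `ε = 1/4`.
    have h6 : ‖latticeCF P (ζ 0) t‖ ≤ 1 - quadForm a b c t / 4 := by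
      rw [h4]
      refine (norm_add_le _ _).trans ?_
      rw [h5]; linarith
    refine h6.trans (le_trans ?_ (Real.add_one_le_exp _))
    linarith
  -- Differences of points of this square stay where the Gaussian bound holds, so values of the
  -- characteristic function far from `0`, possibly of modulus `1`, never enter.
  set μ : Measure (ℝ × ℝ) := volume.restrict (Set.Icc 0 δ ×ˢ Set.Icc 0 δ) with hμ
  have hvol : (volume : Measure (ℝ × ℝ)) (Set.Icc 0 δ ×ˢ Set.Icc 0 δ) =
      ENNReal.ofReal (δ * δ) := by
    rw [Measure.volume_eq_prod, Measure.prod_prod, Real.volume_Icc, sub_zero,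
      ENNReal.ofReal_mul hδpos.le]
  have hfin : IsFiniteMeasure μ := ⟨by
    rw [hμ, Measure.restrict_apply_univ, hvol]; exact ENNReal.ofReal_lt_top⟩
  have hμu : μ.real Set.univ = δ ^ 2 := by
    rw [hμ, measureReal_def, Measure.restrict_apply_univ, hvol, ENNReal.toReal_ofReal
      (by positivity), sq]
  have hmain : ∀ n : ℕ, 0 < n → ∫ z, ‖latticeCF P (ζ 0) (z.1 - z.2) ^ n‖ ∂(μ.prod μ) ≤
      δ ^ 2 * (4 * Real.pi / (κ * n)) := by
    intro n hn
    have hn' : (0 : ℝ) < n := by exact_mod_cast hn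
    set β := κ / 4 * n with hβ
    have hβ0 : 0 < β := by positivity
    obtain ⟨hgi, hgv⟩ := integral_gaussian_prod hβ0
    set F : ℝ × ℝ → ℝ := fun t => Real.exp (-β * (t.1 ^ 2 + t.2 ^ 2)) with hF
    have hFm : Continuous F := by rw [hF]; fun_prop
    have hFint : Integrable (fun z : (ℝ × ℝ) × (ℝ × ℝ) => F (z.1 - z.2)) (μ.prod μ) := by
      refine Integrable.of_bound (by fun_prop) 1 (Eventually.of_forall fun z => ?_)
      rw [Real.norm_of_nonneg (Real.exp_nonneg _), Real.exp_le_one_iff]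
      have : 0 ≤ β * ((z.1 - z.2).1 ^ 2 + (z.1 - z.2).2 ^ 2) := by positivity
      linarith
    have hcf := continuous_latticeCF (P := P) (hζ.measurable 0)
    calc ∫ z, ‖latticeCF P (ζ 0) (z.1 - z.2) ^ n‖ ∂(μ.prod μ)
        ≤ ∫ z, F (z.1 - z.2) ∂(μ.prod μ) := by
          refine integral_mono_ae ?_ hFint ?_
          · refine Integrable.of_bound (by fun_prop) 1 (Eventually.of_forall fun z => ?_)
            rw [norm_norm, norm_pow]
            exact pow_le_one₀ (norm_nonneg _) (norm_latticeCF_le _ _)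
          · rw [hμ, Measure.prod_restrict]
            refine (ae_restrict_mem (by measurability)).mono fun z hz => ?_
            have hz' : ‖z.1 - z.2‖ ≤ δ := by
              simp only [Set.mem_prod, Set.mem_Icc] at hz
              rw [Prod.norm_def, Prod.fst_sub, Prod.snd_sub]
              refine max_le ?_ ?_ <;> rw [Real.norm_eq_abs, abs_le] <;> constructor <;> linarith
            have := pow_le_pow_left₀ (norm_nonneg _) (hdecay _ hz') n
            rw [← Real.exp_nat_mul] at this
            simp only [norm_pow]
            refine this.trans (le_of_eq ?_)
            simp only [hF, hβ]
            ring_nf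
      _ = ∫ x, ∫ y, F (x - y) ∂μ ∂μ := integral_prod _ hFint
      _ ≤ ∫ _, Real.pi / β ∂μ := by
          refine integral_mono hFint.integral_prod_left (integrable_const _) fun x => ?_
          have hsub : Integrable (fun y => F (x - y)) := hgi.comp_sub_left x
          refine (setIntegral_le_integral hsub
            (Eventually.of_forall fun y => Real.exp_nonneg _)).trans (le_of_eq ?_)
          rw [integral_sub_left_eq_self F volume x, hgv]
      _ = δ ^ 2 * (4 * Real.pi / (κ * n)) := by
          rw [integral_const, hμu, smul_eq_mul, hβ]
          field_simp
  refine ⟨max 1 (8 * Real.pi / (κ * δ ^ 2)), fun u v x huv => ?_⟩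
  set n := v - u with hn
  rcases Nat.eq_zero_or_pos n with h0 | hpos
  · rw [h0]
    simp only [Nat.cast_zero, zero_add, div_one]
    exact measureReal_le_one.trans (le_max_left _ _)
  · have hn' : (1 : ℝ) ≤ n := by exact_mod_cast hpos
    have h1 := measureReal_atom_le (P := P) (measurable_incr hζ.measurable huv) x μ
    simp only [latticeCF_incr hζ.measurable hζ.indep hζ.identDistrib huv, hμu, ← hn] at h1
    have h2 := h1.trans (hmain n hpos)
    rw [le_div_iff₀ (by positivity)]
    refine le_trans ?_ (le_max_right _ _)
    have h3 : P.real {ω | incr ζ u v ω = x} ≤ 4 * Real.pi / (κ * n) / δ ^ 2 := by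
      rw [le_div_iff₀ (by positivity)]
      have : (0 : ℝ) < δ ^ 2 := by positivity
      nlinarith
    calc _ ≤ 4 * Real.pi / (κ * n) / δ ^ 2 * (2 * n) := by
          gcongr; linarith
      _ = _ := by field_simp; ring

end SupBound

/-! ### Fourier inversion, Abel sums, and aperiodicity. -/

/-- The fundamental domain `[-π, π]²` of the dual group of `ℤ²`. -/
def freqCube : Set (ℝ × ℝ) := Set.Icc (-Real.pi) Real.pi ×ˢ Set.Icc (-Real.pi) Real.pi

section Inversion

lemma isCompact_freqCube : IsCompact freqCube := isCompact_Icc.prod isCompact_Icc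

lemma measurableSet_freqCube : MeasurableSet freqCube := measurableSet_Icc.prod measurableSet_Icc

lemma integral_exp_int_mul (n : ℤ) :
    ∫ x in Set.Icc (-Real.pi) Real.pi, Complex.exp (Complex.I * ((x * n : ℝ) : ℂ)) =
      if n = 0 then 2 * (Real.pi : ℂ) else 0 := by
  rw [integral_Icc_eq_integral_Ioc, ← intervalIntegral.integral_of_le (by linarith [Real.pi_pos])]
  split_ifs with h
  · simp [h]; ring
  · have hc : Complex.I * (n : ℂ) ≠ 0 := mul_ne_zero Complex.I_ne_zero (by exact_mod_cast h)
    have e : ∀ x : ℝ, Complex.I * ((x * n : ℝ) : ℂ) = (Complex.I * n) * x := by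
      intro x; push_cast; ring
    simp only [e]
    rw [integral_exp_mul_complex hc, div_eq_zero_iff]
    left
    rw [sub_eq_zero]
    refine Complex.exp_eq_exp_iff_exists_int.2 ⟨n, ?_⟩
    push_cast; ring

lemma integral_latticeChar_freqCube (y : Fin 2 → ℤ) :
    ∫ t in freqCube, latticeChar t y = if y = 0 then (2 * (Real.pi : ℂ)) ^ 2 else 0 := by
  have e : ∀ t : ℝ × ℝ, latticeChar t y =
      Complex.exp (Complex.I * ((t.1 * y 0 : ℝ) : ℂ)) *
        Complex.exp (Complex.I * ((t.2 * y 1 : ℝ) : ℂ)) := by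
    intro t
    rw [latticeChar, freqDot, ← Complex.exp_add]
    congr 1
    push_cast
    ring
  simp only [e, freqCube]
  rw [Measure.volume_eq_prod, setIntegral_prod_mul
    (fun x : ℝ => Complex.exp (Complex.I * ((x * y 0 : ℝ) : ℂ)))
    (fun x : ℝ => Complex.exp (Complex.I * ((x * y 1 : ℝ) : ℂ))), integral_exp_int_mul,
    integral_exp_int_mul]
  by_cases h0 : y 0 = 0 <;> by_cases h1 : y 1 = 0
  · have : y = 0 := by ext i; fin_cases i <;> assumption
    simp [this, sq]
  · have : y ≠ 0 := fun h => h1 (by simp [h])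
    simp [h1, this]
  · have : y ≠ 0 := fun h => h0 (by simp [h])
    simp [h0, this]
  · have : y ≠ 0 := fun h => h0 (by simp [h])
    simp [h0, this]

instance : IsFiniteMeasure ((volume : Measure (ℝ × ℝ)).restrict freqCube) :=
  ⟨by rw [Measure.restrict_apply_univ]; exact isCompact_freqCube.measure_lt_top⟩

variable {Ω : Type*} [MeasurableSpace Ω] {P : Measure Ω} [IsProbabilityMeasure P]

/-- Fourier inversion for random vectors with values in `ℤ²`. -/
lemma integral_latticeCF_mul {X : Ω → (Fin 2 → ℤ)} (hX : Measurable X) (p : Fin 2 → ℤ) :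
    ∫ t in freqCube, latticeCF P X t * latticeChar t (-p) =
      (2 * (Real.pi : ℂ)) ^ 2 * (P.real {ω | X ω = p} : ℂ) := by
  have hmeas : Measurable fun w : (ℝ × ℝ) × Ω => latticeChar w.1 (X w.2 + -p) :=
    measurable_latticeChar_uncurry.comp (measurable_fst.prodMk
      ((hX.comp measurable_snd).add_const (-p)))
  have hint : Integrable (Function.uncurry fun (t : ℝ × ℝ) (ω : Ω) => latticeChar t (X ω + -p))
      ((volume.restrict freqCube).prod P) :=
    Integrable.of_bound hmeas.aestronglyMeasurable 1
      (Eventually.of_forall fun _ => (norm_latticeChar _ _).le)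
  have hset : MeasurableSet {ω | X ω = p} := hX (measurableSet_singleton p)
  have e : ∀ t, latticeCF P X t * latticeChar t (-p) = ∫ ω, latticeChar t (X ω + -p) ∂P := by
    intro t
    simp only [latticeChar_add]
    rw [integral_mul_const]
    rfl
  simp only [e]
  rw [integral_integral_swap hint]
  simp only [integral_latticeChar_freqCube]
  have e2 : (fun ω => if X ω + -p = 0 then (2 * (Real.pi : ℂ)) ^ 2 else 0) =
      {ω | X ω = p}.indicator fun _ => (2 * (Real.pi : ℂ)) ^ 2 := by
    funext ω
    simp only [Set.indicator_apply, Set.mem_ofPred_eq, ← sub_eq_add_neg, sub_eq_zero]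
  rw [e2, integral_indicator_const _ hset, Complex.real_smul, mul_comm]

/-- The Abel sums of the return probabilities as a Fourier integral. -/
lemma hasSum_abel {ζ : ℕ → Ω → (Fin 2 → ℤ)} (hζ : IsPlanarWalkSteps P ζ) (p : Fin 2 → ℤ)
    {r : ℝ} (hr0 : 0 ≤ r) (hr1 : r < 1) :
    HasSum (fun k : ℕ => (2 * (Real.pi : ℂ)) ^ 2 *
        ((r ^ k * P.real {ω | incr ζ 0 k ω = p} : ℝ) : ℂ))
      (∫ t in freqCube, latticeChar t (-p) / (1 - r * latticeCF P (ζ 0) t)) := by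
  have hcf := continuous_latticeCF (P := P) (hζ.measurable 0)
  have hlt : ∀ t, ‖(r : ℂ) * latticeCF P (ζ 0) t‖ ≤ r := by
    intro t
    rw [norm_mul, Complex.norm_real, Real.norm_of_nonneg hr0]
    exact mul_le_of_le_one_right hr0 (norm_latticeCF_le _ _)
  have h := hasSum_integral_of_dominated_convergence
    (μ := (volume : Measure (ℝ × ℝ)).restrict freqCube)
    (F := fun (k : ℕ) t => ((r : ℂ) * latticeCF P (ζ 0) t) ^ k * latticeChar t (-p))
    (f := fun t => latticeChar t (-p) / (1 - r * latticeCF P (ζ 0) t))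
    (fun k _ => r ^ k) (fun k => by fun_prop)
    (fun k => Eventually.of_forall fun t => by
      rw [norm_mul, norm_latticeChar, mul_one, norm_pow]
      exact pow_le_pow_left₀ (norm_nonneg _) (hlt t) k)
    (Eventually.of_forall fun t => summable_geometric_of_lt_one hr0 hr1)
    (integrable_const _)
    (Eventually.of_forall fun t => by
      have := (hasSum_geometric_of_norm_lt_one ((hlt t).trans_lt hr1)).mul_right
        (latticeChar t (-p))
      rwa [inv_mul_eq_div] at this)
  have hterm : ∀ k : ℕ, ∫ t in freqCube, ((r : ℂ) * latticeCF P (ζ 0) t) ^ k *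
      latticeChar t (-p) = (2 * (Real.pi : ℂ)) ^ 2 *
        ((r ^ k * P.real {ω | incr ζ 0 k ω = p} : ℝ) : ℂ) := by
    intro k
    have e : ∀ t, ((r : ℂ) * latticeCF P (ζ 0) t) ^ k * latticeChar t (-p) =
        (r : ℂ) ^ k * (latticeCF P (incr ζ 0 k) t * latticeChar t (-p)) := by
      intro t
      rw [latticeCF_incr hζ.measurable hζ.indep hζ.identDistrib (Nat.zero_le k), Nat.sub_zero,
        mul_pow, mul_assoc]
    simp only [e]
    rw [integral_const_mul,
      integral_latticeCF_mul (measurable_incr hζ.measurable (Nat.zero_le k))]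
    push_cast
    ring
  simpa only [hterm] using h

/-- Aperiodicity: on the fundamental domain the characteristic function of a step takes the value
`1` only at `0`. -/
lemma eq_zero_of_latticeCF_eq_one {ζ : ℕ → Ω → (Fin 2 → ℤ)} (hζ : IsPlanarWalkSteps P ζ)
    {t : ℝ × ℝ} (ht : t ∈ freqCube) (h : latticeCF P (ζ 0) t = 1) : t = 0 := by
  have hi := integrable_latticeChar_comp (P := P) (hζ.measurable 0) t
  have hre : ∫ ω, (1 - (latticeChar t (ζ 0 ω)).re) ∂P = 0 := by
    have h1 : ∫ ω, (latticeChar t (ζ 0 ω)).re ∂P = (latticeCF P (ζ 0) t).re :=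
      integral_re hi
    have hir : Integrable (fun ω => (latticeChar t (ζ 0 ω)).re) P := hi.re
    rw [integral_sub (integrable_const _) hir, h1, h]
    simp
  have hle : ∀ ω, 0 ≤ 1 - (latticeChar t (ζ 0 ω)).re := fun ω => by
    have := (Complex.re_le_norm (latticeChar t (ζ 0 ω))).trans (norm_latticeChar _ _).le
    linarith
  rw [integral_eq_zero_iff_of_nonneg hle ((integrable_const _).sub hi.re)] at hre
  have hone : ∀ z : ℂ, ‖z‖ = 1 → z.re = 1 → z = 1 := by
    intro z hz hzr
    have h2 := Complex.sq_norm z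
    rw [hz, Complex.normSq_apply, hzr] at h2
    have h3 : z.im = 0 := by nlinarith
    exact Complex.ext hzr h3
  -- The kernel of the character is a subgroup. It contains every possible step, since a mean equal
  -- to `1` of unit complex numbers forces them all to be `1`; hence it is all of `ℤ²`.
  let H : AddSubgroup (Fin 2 → ℤ) :=
    { carrier := {x | latticeChar t x = 1}
      zero_mem' := latticeChar_zero_right t
      add_mem' := fun {x y} hx hy => by
        change latticeChar t (x + y) = 1
        rw [latticeChar_add, show latticeChar t x = 1 from hx, show latticeChar t y = 1 from hy,
          mul_one]
      neg_mem' := fun {x} hx => by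
        change latticeChar t (-x) = 1
        have h2 := latticeChar_add t x (-x)
        rwa [add_neg_cancel, latticeChar_zero_right, show latticeChar t x = 1 from hx, one_mul,
          eq_comm] at h2 }
  have hH : H = ⊤ := by
    rw [eq_top_iff, ← hζ.aperiodic, AddSubgroup.closure_le]
    intro l hl
    obtain ⟨ω, hω, hω'⟩ := ((frequently_ae_mem_iff.2 (ne_of_gt hl)).and_eventually hre).exists
    have h2 : ζ 0 ω = l := hω
    simp only [h2, Pi.zero_apply] at hω'
    exact hone _ (norm_latticeChar _ _) (by linarith)
  have hcoord : ∀ x : ℝ, x ∈ Set.Icc (-Real.pi) Real.pi →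
      Complex.exp (Complex.I * (x : ℂ)) = 1 → x = 0 := by
    intro x hx hexp
    obtain ⟨n, hn⟩ := Complex.exp_eq_one_iff.1 hexp
    have hn' : x = n * (2 * Real.pi) := by
      have h2 : Complex.I * (x : ℂ) = Complex.I * ((n * (2 * Real.pi) : ℝ) : ℂ) := by
        rw [hn]; push_cast; ring
      exact_mod_cast mul_left_cancel₀ Complex.I_ne_zero h2
    have hpi := Real.pi_pos
    have h0 : n = 0 := by
      by_contra hne
      rcases lt_or_gt_of_ne hne with h3 | h3
      · have : (n : ℝ) ≤ -1 := by exact_mod_cast Int.le_sub_one_of_lt h3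
        nlinarith [hx.1]
      · have : (1 : ℝ) ≤ n := by exact_mod_cast h3
        nlinarith [hx.2]
    simp [hn', h0]
  have hmem : ∀ x : Fin 2 → ℤ, latticeChar t x = 1 := fun x =>
    (show x ∈ H by rw [hH]; exact AddSubgroup.mem_top x)
  have h0 := hmem ![1, 0]
  have h1 := hmem ![0, 1]
  simp only [latticeChar, freqDot, Matrix.cons_val_zero, Matrix.cons_val_one, Int.cast_one,
    Int.cast_zero, mul_one, mul_zero, add_zero, zero_add] at h0 h1
  exact Prod.ext (hcoord _ ht.1 h0) (hcoord _ ht.2 h1)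

end Inversion

/-! ### Integrals of functions of a positive definite quadratic form. -/

section EllipseIntegral

lemma integral_radial (f : ℝ → ℝ) :
    ∫ t : ℝ × ℝ, f (t.1 ^ 2 + t.2 ^ 2) = 2 * Real.pi * ∫ r in Set.Ioi (0 : ℝ), r * f (r ^ 2) := by
  rw [← integral_comp_polarCoord_symm]
  have e : ∀ z : ℝ × ℝ, z.1 • f ((polarCoord.symm z).1 ^ 2 + (polarCoord.symm z).2 ^ 2) =
      (z.1 * f (z.1 ^ 2)) * 1 := by
    intro z
    rw [polarCoord_symm_apply, smul_eq_mul, mul_one]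
    congr 2
    simp only
    linear_combination z.1 ^ 2 * Real.cos_sq_add_sin_sq z.2
  simp only [e, polarCoord_target]
  rw [Measure.volume_eq_prod, setIntegral_prod_mul (fun r : ℝ => r * f (r ^ 2)) (fun _ => (1 : ℝ))]
  have hpi : ∫ _ in Set.Ioo (-Real.pi) Real.pi, (1 : ℝ) = 2 * Real.pi := by
    simp [Real.pi_pos.le, two_mul]
  rw [hpi, mul_comm]

lemma integral_comp_quadForm {a b c : ℝ} (ha : 0 < a) (hd : 0 < a * c - b ^ 2) {f : ℝ → ℝ}
    (hf : Measurable f) :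
    ∫ t : ℝ × ℝ, f (quadForm a b c t) =
      2 * Real.pi / Real.sqrt (a * c - b ^ 2) * ∫ r in Set.Ioi (0 : ℝ), r * f (r ^ 2) := by
  set d := a * c - b ^ 2 with hdd
  have hsa : 0 < Real.sqrt a := Real.sqrt_pos.2 ha
  have hsd : 0 < Real.sqrt d := Real.sqrt_pos.2 hd
  have hsa2 : Real.sqrt a ^ 2 = a := Real.sq_sqrt ha.le
  have hsd2 : Real.sqrt d ^ 2 = d := Real.sq_sqrt hd.le
  -- An inverse Cholesky factor of the form: it turns `q` into the squared Euclidean length, and its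
  -- determinant is `1/√(ac - b²)`.
  set A : Matrix (Fin 2) (Fin 2) ℝ :=
    !![1 / Real.sqrt a, -b / (Real.sqrt a * Real.sqrt d); 0, Real.sqrt a / Real.sqrt d] with hA
  set L := Matrix.toLin (Module.Basis.finTwoProd ℝ) (Module.Basis.finTwoProd ℝ) A with hL
  have hdet : LinearMap.det L = 1 / Real.sqrt d := by
    rw [hL, LinearMap.det_toLin, hA, Matrix.det_fin_two_of]
    field_simp
    ring
  have hLapp : ∀ z : ℝ × ℝ, L z = (1 / Real.sqrt a * z.1 + -b / (Real.sqrt a * Real.sqrt d) * z.2,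
      Real.sqrt a / Real.sqrt d * z.2) := by
    intro z
    rw [hL, hA, Matrix.toLin_finTwoProd_apply]
    simp
  have hq : ∀ z, quadForm a b c (L z) = z.1 ^ 2 + z.2 ^ 2 := by
    intro z
    have hc : c = (d + b ^ 2) / a := by rw [hdd]; field_simp; ring
    have key : ∀ α δ x y : ℝ, 0 < α → 0 < δ →
        α ^ 2 * (1 / α * x + -b / (α * δ) * y) ^ 2 +
          2 * b * ((1 / α * x + -b / (α * δ) * y) * (α / δ * y)) +
          (δ ^ 2 + b ^ 2) / α ^ 2 * (α / δ * y) ^ 2 = x ^ 2 + y ^ 2 := by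
      intro α δ x y hα hδ
      field_simp
      ring
    have h1 := key _ _ z.1 z.2 hsa hsd
    rw [hsa2, hsd2, ← hc] at h1
    rw [hLapp, quadForm]
    exact h1
  have hLm : Measurable L := (LinearMap.continuous_of_finiteDimensional L).measurable
  have hqm : Measurable fun t => f (quadForm a b c t) :=
    hf.comp (by unfold quadForm; fun_prop)
  have hmap := integral_map (μ := (volume : Measure (ℝ × ℝ))) hLm.aemeasurable
    (f := fun t => f (quadForm a b c t)) hqm.aestronglyMeasurable
  rw [Measure.map_linearMap_addHaar_eq_smul_addHaar volume (by rw [hdet]; positivity), hdet,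
    integral_smul_measure, one_div, inv_inv, abs_of_pos hsd,
    ENNReal.toReal_ofReal hsd.le, smul_eq_mul] at hmap
  simp only [hq] at hmap
  rw [integral_radial] at hmap
  field_simp
  linarith

lemma integral_quadForm_ellipse {a b c : ℝ} (ha : 0 < a) (hd : 0 < a * c - b ^ 2) {s ρ : ℝ}
    (hs : 0 < s) (hρ : 0 < ρ) :
    ∫ t in {t | quadForm a b c t < ρ ^ 2}, 1 / (s + quadForm a b c t / 2) =
      2 * Real.pi / Real.sqrt (a * c - b ^ 2) * (Real.log (s + ρ ^ 2 / 2) - Real.log s) := by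
  have hqc : Continuous (quadForm a b c) := by unfold quadForm; fun_prop
  have hE : MeasurableSet {t | quadForm a b c t < ρ ^ 2} :=
    (isOpen_lt hqc continuous_const).measurableSet
  rw [← integral_indicator hE]
  have e : ({t | quadForm a b c t < ρ ^ 2}.indicator fun t => 1 / (s + quadForm a b c t / 2)) =
      fun t => (Set.Iio (ρ ^ 2)).indicator (fun x => 1 / (s + x / 2)) (quadForm a b c t) := by
    funext t
    simp only [Set.indicator_apply, Set.mem_ofPred_eq, Set.mem_Iio]
  rw [e, integral_comp_quadForm ha hd (Measurable.indicator (by fun_prop) measurableSet_Iio)]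
  congr 1
  have e2 : ∀ r ∈ Set.Ioi (0 : ℝ), r * (Set.Iio (ρ ^ 2)).indicator (fun x => 1 / (s + x / 2)) (r ^ 2) =
      (Set.Iio ρ).indicator (fun r => r / (s + r ^ 2 / 2)) r := by
    intro r hr
    have : r ^ 2 < ρ ^ 2 ↔ r < ρ := pow_lt_pow_iff_left₀ (le_of_lt hr) hρ.le two_ne_zero
    simp only [Set.indicator_apply, Set.mem_Iio, this]
    split_ifs <;> ring
  rw [setIntegral_congr_fun measurableSet_Ioi e2, setIntegral_indicator measurableSet_Iio,
    Set.Ioi_inter_Iio, ← integral_Ioc_eq_integral_Ioo, ← intervalIntegral.integral_of_le hρ.le]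
  have hderiv : ∀ x ∈ Set.uIcc 0 ρ,
      HasDerivAt (fun r => Real.log (s + r ^ 2 / 2)) (x / (s + x ^ 2 / 2)) x := by
    intro x _
    have h1 : HasDerivAt (fun r : ℝ => s + r ^ 2 / 2) x x := by
      exact (((hasDerivAt_pow 2 x).div_const 2).const_add s).congr_deriv (by norm_num)
    exact h1.log (by positivity)
  rw [intervalIntegral.integral_eq_sub_of_hasDerivAt hderiv]
  · simp
  · refine Continuous.intervalIntegrable ?_ _ _
    exact continuous_id.div (by fun_prop) fun x => by positivity

end EllipseIntegral

/-! ### The logarithmic singularity of the Green function. -/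

section Green

variable {Ω : Type*} [MeasurableSpace Ω] {P : Measure Ω} [IsProbabilityMeasure P]

/-- Comparison of the resolvent `1 / (1 - (1 - s) φ)` with that of the quadratic form. -/
lemma norm_resolvent_sub_le {φ e : ℂ} {s q ε : ℝ} (hs0 : 0 < s) (hs1 : s < 1) (hq : 0 ≤ q)
    (hε : ε ≤ 1 / 4) (hφ : ‖φ - 1 + ((q / 2 : ℝ) : ℂ)‖ ≤ ε * q) (he : ‖e - 1‖ ≤ ε)
    (hqs : q ≤ 2 * ε) :
    ‖e / (1 - ((1 - s : ℝ) : ℂ) * φ) - ((1 / (s + q / 2) : ℝ) : ℂ)‖ ≤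
      6 * ε * (1 / (s + q / 2)) := by
  set v := s + q / 2 with hv
  have hv0 : 0 < v := by positivity
  have hε0 : 0 ≤ ε := (norm_nonneg _).trans he
  set w := 1 - ((1 - s : ℝ) : ℂ) * φ with hw
  have hwv : ‖(v : ℂ) - w‖ ≤ 2 * ε * v := by
    have e1 : (v : ℂ) - w = ((1 - s : ℝ) : ℂ) * (φ - 1 + ((q / 2 : ℝ) : ℂ)) +
        ((s * (q / 2) : ℝ) : ℂ) := by
      rw [hw, hv]; push_cast; ring
    rw [e1]
    refine (norm_add_le _ _).trans ?_
    rw [norm_mul, Complex.norm_real, Complex.norm_real, Real.norm_of_nonneg (by linarith),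
      Real.norm_of_nonneg (by positivity)]
    have h1 : (1 - s) * ‖φ - 1 + ((q / 2 : ℝ) : ℂ)‖ ≤ 1 * (ε * q) :=
      mul_le_mul (by linarith) hφ (norm_nonneg _) zero_le_one
    have h2 : s * (q / 2) ≤ s * ε := by gcongr; linarith
    rw [hv]
    nlinarith
  have hwn : v / 2 ≤ ‖w‖ := by
    have h1 := norm_sub_norm_le (v : ℂ) w
    rw [Complex.norm_real, Real.norm_of_nonneg hv0.le] at h1
    nlinarith
  have hw0 : w ≠ 0 := norm_pos_iff.1 (lt_of_lt_of_le (by positivity) hwn)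
  have hvc : (v : ℂ) ≠ 0 := by exact_mod_cast hv0.ne'
  have e2 : e / w - ((1 / v : ℝ) : ℂ) = ((e - 1) * v + ((v : ℂ) - w)) / (w * v) := by
    push_cast
    field_simp
    ring
  rw [e2, norm_div, norm_mul, Complex.norm_real, Real.norm_of_nonneg hv0.le,
    div_le_iff₀ (by positivity)]
  have h3 : ‖(e - 1) * v + ((v : ℂ) - w)‖ ≤ 3 * ε * v := by
    refine (norm_add_le _ _).trans ?_
    rw [norm_mul, Complex.norm_real, Real.norm_of_nonneg hv0.le]
    nlinarith
  refine h3.trans ?_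
  have h4 : 6 * ε * (1 / v) * (‖w‖ * v) = 6 * ε * ‖w‖ := by field_simp
  rw [h4]
  nlinarith

/-- The singular part of the Green integral on a small ellipse around the origin. -/
lemma exists_ellipse_bound {φ χ : ℝ × ℝ → ℂ} (hφc : Continuous φ) (hχc : Continuous χ)
    (hχ0 : χ 0 = 1) {a b c : ℝ} (ha : 0 < a) (hd : 0 < a * c - b ^ 2)
    (hexp : ∀ ε > 0, ∃ δ > 0, ∀ t : ℝ × ℝ, ‖t‖ < δ →
        ‖φ t - 1 + ((quadForm a b c t / 2 : ℝ) : ℂ)‖ ≤ ε * quadForm a b c t) {ε : ℝ}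
    (hε : 0 < ε) (hε4 : ε ≤ 1 / 4) :
    ∃ ρ > 0, {t | quadForm a b c t < ρ ^ 2} ⊆ freqCube ∧ ∀ s : ℝ, 0 < s → s < 1 →
      IntegrableOn (fun t => χ t / (1 - ((1 - s : ℝ) : ℂ) * φ t))
        {t | quadForm a b c t < ρ ^ 2} ∧
      ‖(∫ t in {t | quadForm a b c t < ρ ^ 2}, χ t / (1 - ((1 - s : ℝ) : ℂ) * φ t)) -
        ((2 * Real.pi / Real.sqrt (a * c - b ^ 2) *
          (Real.log (s + ρ ^ 2 / 2) - Real.log s) : ℝ) : ℂ)‖ ≤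
        6 * ε * (2 * Real.pi / Real.sqrt (a * c - b ^ 2) *
          (Real.log (s + ρ ^ 2 / 2) - Real.log s)) := by
  have hcpos : 0 < c := by
    by_contra h
    nlinarith [sq_nonneg b]
  set κ := (a * c - b ^ 2) / (a + c) with hκ
  have hκ0 : 0 < κ := by positivity
  have hqc : Continuous (quadForm a b c) := by unfold quadForm; fun_prop
  have hq0 : Tendsto (quadForm a b c) (𝓝 0) (𝓝 0) := by
    have := hqc.tendsto 0
    simpa [quadForm] using this
  have hqnn : ∀ t, 0 ≤ quadForm a b c t := fun t =>
    le_trans (by positivity) (quadForm_lower ha hd t)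
  obtain ⟨δ₀, hδ₀, hexp⟩ := hexp ε hε
  obtain ⟨δ₁, hδ₁, hq1⟩ := Metric.eventually_nhds_iff.1
    (hq0.eventually (gt_mem_nhds (show (0 : ℝ) < 2 * ε by positivity)))
  have hχ1 : Tendsto (fun t => ‖χ t - 1‖) (𝓝 0) (𝓝 0) := by
    have h : Continuous fun t => ‖χ t - 1‖ := by fun_prop
    simpa [hχ0] using h.tendsto 0
  obtain ⟨δ₂, hδ₂, hχ2⟩ := Metric.eventually_nhds_iff.1 (hχ1.eventually (gt_mem_nhds hε))
  set δ := min (min δ₀ δ₁) (min δ₂ Real.pi) with hδ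
  have hδ0 : 0 < δ := lt_min (lt_min hδ₀ hδ₁) (lt_min hδ₂ Real.pi_pos)
  -- Since `q ≥ κ|t|²`, the ellipse `q < κδ²` lies in the ball of radius `δ`.
  set ρ := Real.sqrt κ * δ with hρ
  have hρ0 : 0 < ρ := by positivity
  have hρ2 : ρ ^ 2 = κ * δ ^ 2 := by rw [hρ, mul_pow, Real.sq_sqrt hκ0.le]
  set E := {t | quadForm a b c t < ρ ^ 2} with hE
  have hEm : MeasurableSet E := (isOpen_lt hqc continuous_const).measurableSet
  have hEδ : ∀ t ∈ E, ‖t‖ < δ := by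
    intro t ht
    have h1 := quadForm_lower ha hd t
    rw [← hκ] at h1
    have h2 : κ * (t.1 ^ 2 + t.2 ^ 2) < κ * δ ^ 2 := by
      rw [← hρ2]; exact h1.trans_lt ht
    have h3 := lt_of_mul_lt_mul_left h2 hκ0.le
    rw [Prod.norm_def, Real.norm_eq_abs, Real.norm_eq_abs]
    refine max_lt (abs_lt_of_sq_lt_sq ?_ hδ0.le) (abs_lt_of_sq_lt_sq ?_ hδ0.le) <;>
      nlinarith [sq_nonneg t.1, sq_nonneg t.2]
  have hEQ : E ⊆ freqCube := by
    intro t ht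
    have h1 : ‖t‖ < Real.pi := (hEδ t ht).trans_le ((min_le_right _ _).trans (min_le_right _ _))
    rw [Prod.norm_def, max_lt_iff, Real.norm_eq_abs, Real.norm_eq_abs] at h1
    exact ⟨abs_le.1 h1.1.le, abs_le.1 h1.2.le⟩
  have hfin : IsFiniteMeasure ((volume : Measure (ℝ × ℝ)).restrict E) :=
    ⟨by rw [Measure.restrict_apply_univ]
        exact (measure_mono hEQ).trans_lt isCompact_freqCube.measure_lt_top⟩
  refine ⟨ρ, hρ0, hEQ, fun s hs0 hs1 => ?_⟩
  rw [← integral_quadForm_ellipse ha hd hs0 hρ0]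
  have hvint : IntegrableOn (fun t => 1 / (s + quadForm a b c t / 2)) E := by
    refine Integrable.of_bound (C := 1 / s) ?_ (Eventually.of_forall fun t => ?_)
    · refine Measurable.aestronglyMeasurable ?_
      exact measurable_const.div ((hqc.measurable.div_const 2).const_add s)
    · have := hqnn t
      rw [Real.norm_of_nonneg (by positivity)]
      exact one_div_le_one_div_of_le hs0 (by linarith)
  have hpt : ∀ t ∈ E, ‖χ t / (1 - ((1 - s : ℝ) : ℂ) * φ t) -
      ((1 / (s + quadForm a b c t / 2) : ℝ) : ℂ)‖ ≤
        6 * ε * (1 / (s + quadForm a b c t / 2)) := by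
    intro t ht
    have h1 := hEδ t ht
    refine norm_resolvent_sub_le hs0 hs1 (hqnn t) hε4
      (hexp t (h1.trans_le ((min_le_left _ _).trans (min_le_left _ _)))) (le_of_lt (hχ2 ?_))
      (le_of_lt (hq1 ?_))
    · simpa using h1.trans_le ((min_le_right _ _).trans (min_le_left _ _))
    · simpa using h1.trans_le ((min_le_left _ _).trans (min_le_right _ _))
  have hdiff : IntegrableOn (fun t => χ t / (1 - ((1 - s : ℝ) : ℂ) * φ t) -
      ((1 / (s + quadForm a b c t / 2) : ℝ) : ℂ)) E := by
    refine Integrable.mono' (hvint.const_mul (6 * ε)) ?_ ?_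
    · refine Measurable.aestronglyMeasurable ?_
      refine (hχc.measurable.div (by fun_prop)).sub ?_
      exact Complex.measurable_ofReal.comp
        (measurable_const.div ((hqc.measurable.div_const 2).const_add s))
    · exact (ae_restrict_mem hEm).mono hpt
  have hvc : IntegrableOn (fun t => ((1 / (s + quadForm a b c t / 2) : ℝ) : ℂ)) E := hvint.ofReal
  have hmain : IntegrableOn (fun t => χ t / (1 - ((1 - s : ℝ) : ℂ) * φ t)) E := by
    exact (hdiff.add hvc).congr (Eventually.of_forall fun t => sub_add_cancel _ _)
  refine ⟨hmain, ?_⟩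
  rw [← integral_complex_ofReal, ← integral_sub hmain hvc, ← integral_const_mul]
  exact norm_integral_le_of_norm_le (hvint.const_mul (6 * ε)) ((ae_restrict_mem hEm).mono hpt)

/-- The ellipse carries the logarithm. Away from it the denominator is bounded below uniformly in
`s`, by compactness, so the rest of the domain adds only a constant. -/
lemma exists_green_integral_bound {φ χ : ℝ × ℝ → ℂ} (hφc : Continuous φ) (hχc : Continuous χ)
    (hχ0 : χ 0 = 1) (hχ : ∀ t, ‖χ t‖ ≤ 1) (hφ1 : ∀ t, ‖φ t‖ ≤ 1)
    (hφ : ∀ t ∈ freqCube, φ t = 1 → t = 0)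
    {a b c : ℝ} (ha : 0 < a) (hd : 0 < a * c - b ^ 2)
    (hexp : ∀ ε > 0, ∃ δ > 0, ∀ t : ℝ × ℝ, ‖t‖ < δ →
        ‖φ t - 1 + ((quadForm a b c t / 2 : ℝ) : ℂ)‖ ≤ ε * quadForm a b c t) {ε : ℝ}
    (hε : 0 < ε) :
    ∃ K : ℝ, ∀ s : ℝ, 0 < s → s < 1 →
      ‖(∫ t in freqCube, χ t / (1 - ((1 - s : ℝ) : ℂ) * φ t)) -
        ((2 * Real.pi / Real.sqrt (a * c - b ^ 2) * (-Real.log s) : ℝ) : ℂ)‖ ≤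
        ε * (-Real.log s) + K := by
  set A := 2 * Real.pi / Real.sqrt (a * c - b ^ 2) with hA
  have hA0 : 0 < A := by
    have := Real.sqrt_pos.2 hd
    have := Real.pi_pos
    positivity
  have hqc : Continuous (quadForm a b c) := by unfold quadForm; fun_prop
  set ε' := min (1 / 4) (ε / (6 * A)) with hε'
  have hε'0 : 0 < ε' := lt_min (by norm_num) (by positivity)
  obtain ⟨ρ, hρ, hEQ, hE⟩ := exists_ellipse_bound hφc hχc hχ0 ha hd hexp hε'0 (min_le_left _ _)
  set E := {t | quadForm a b c t < ρ ^ 2} with hEdef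
  have hEo : IsOpen E := isOpen_lt hqc continuous_const
  -- The endpoint `s = 0` is included to get uniformity as `s → 0`; only there is the hypothesis on
  -- the solutions of `φ = 1` needed.
  have hcomp : IsCompact (Set.Icc (0 : ℝ) 1 ×ˢ (freqCube \ E)) :=
    isCompact_Icc.prod (isCompact_freqCube.diff hEo)
  have hcont : Continuous fun z : ℝ × (ℝ × ℝ) => ‖1 - ((1 - z.1 : ℝ) : ℂ) * φ z.2‖ := by fun_prop
  have hpos : ∀ z ∈ Set.Icc (0 : ℝ) 1 ×ˢ (freqCube \ E),
      0 < ‖1 - ((1 - z.1 : ℝ) : ℂ) * φ z.2‖ := by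
    rintro ⟨s, t⟩ ⟨hs, htQ, htE⟩
    rw [norm_pos_iff, sub_ne_zero]
    intro h
    simp only [Set.mem_Icc] at hs htQ htE h
    have h1 : (1 : ℝ) = (1 - s) * ‖φ t‖ := by
      have := congrArg norm h
      rwa [norm_one, norm_mul, Complex.norm_real, Real.norm_of_nonneg (by linarith)] at this
    have hs0 : s = 0 := by nlinarith [hφ1 t, norm_nonneg (φ t)]
    have ht0 := hφ t htQ (by rw [hs0] at h; simpa using h.symm)
    apply htE
    rw [ht0, hEdef]
    simp only [Set.mem_ofPred_eq, quadForm]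
    norm_num
    positivity
  obtain ⟨m, hm0, hm⟩ : ∃ m > 0, ∀ z ∈ Set.Icc (0 : ℝ) 1 ×ˢ (freqCube \ E),
      m ≤ ‖1 - ((1 - z.1 : ℝ) : ℂ) * φ z.2‖ := by
    rcases (Set.Icc (0 : ℝ) 1 ×ˢ (freqCube \ E)).eq_empty_or_nonempty with h | h
    · exact ⟨1, one_pos, by simp [h]⟩
    · obtain ⟨z, hz, hmin⟩ := hcomp.exists_isMinOn h hcont.continuousOn
      exact ⟨_, hpos z hz, fun y hy => hmin hy⟩
  set B := max |Real.log (ρ ^ 2 / 2)| |Real.log (1 + ρ ^ 2 / 2)| with hB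
  set V := (volume : Measure (ℝ × ℝ)).real (freqCube \ E) with hV
  refine ⟨1 / m * V + (A + ε) * B, fun s hs0 hs1 => ?_⟩
  obtain ⟨hintE, hbound⟩ := hE s hs0 hs1
  have hQEm : MeasurableSet (freqCube \ E) := measurableSet_freqCube.diff hEo.measurableSet
  have hQEfin : (volume : Measure (ℝ × ℝ)) (freqCube \ E) < ⊤ :=
    (measure_mono Set.sdiff_subset).trans_lt isCompact_freqCube.measure_lt_top
  have hb : ∀ t ∈ freqCube \ E, ‖χ t / (1 - ((1 - s : ℝ) : ℂ) * φ t)‖ ≤ 1 / m := by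
    intro t ht
    rw [norm_div]
    exact div_le_div₀ zero_le_one (hχ t) hm0 (hm (s, t) ⟨⟨hs0.le, hs1.le⟩, ht⟩)
  have hintQE : IntegrableOn (fun t => χ t / (1 - ((1 - s : ℝ) : ℂ) * φ t)) (freqCube \ E) := by
    have : IsFiniteMeasure ((volume : Measure (ℝ × ℝ)).restrict (freqCube \ E)) :=
      ⟨by rwa [Measure.restrict_apply_univ]⟩
    refine Integrable.of_bound (C := 1 / m) ?_ ((ae_restrict_mem hQEm).mono hb)
    exact (hχc.measurable.div (by fun_prop)).aestronglyMeasurable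
  have hsplit : ∫ t in freqCube, χ t / (1 - ((1 - s : ℝ) : ℂ) * φ t) =
      (∫ t in freqCube \ E, χ t / (1 - ((1 - s : ℝ) : ℂ) * φ t)) +
        ∫ t in E, χ t / (1 - ((1 - s : ℝ) : ℂ) * φ t) := by
    rw [← setIntegral_union Set.disjoint_sdiff_left hEo.measurableSet hintQE hintE,
      Set.sdiff_union_of_subset hEQ]
  have hout : ‖∫ t in freqCube \ E, χ t / (1 - ((1 - s : ℝ) : ℂ) * φ t)‖ ≤ 1 / m * V :=
    norm_setIntegral_le_of_norm_le_const hQEfin hb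
  have hlogB : |Real.log (s + ρ ^ 2 / 2)| ≤ B := by
    have h1 : Real.log (ρ ^ 2 / 2) ≤ Real.log (s + ρ ^ 2 / 2) :=
      Real.log_le_log (by positivity) (by linarith)
    have h2 : Real.log (s + ρ ^ 2 / 2) ≤ Real.log (1 + ρ ^ 2 / 2) :=
      Real.log_le_log (by positivity) (by linarith)
    exact abs_le_max_abs_abs h1 h2
  have hls : 0 ≤ -Real.log s := by
    have := Real.log_nonpos hs0.le hs1.le
    linarith
  have hεA : 6 * ε' * A ≤ ε := by
    have : ε' ≤ ε / (6 * A) := min_le_right _ _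
    rw [le_div_iff₀ (by positivity)] at this
    linarith
  set L := Real.log (s + ρ ^ 2 / 2) with hL
  have e : (∫ t in freqCube, χ t / (1 - ((1 - s : ℝ) : ℂ) * φ t)) -
      ((A * (-Real.log s) : ℝ) : ℂ) =
      (∫ t in freqCube \ E, χ t / (1 - ((1 - s : ℝ) : ℂ) * φ t)) +
        ((∫ t in E, χ t / (1 - ((1 - s : ℝ) : ℂ) * φ t)) -
          ((A * (L - Real.log s) : ℝ) : ℂ)) + ((A * L : ℝ) : ℂ) := by
    rw [hsplit]; push_cast; ring
  rw [e]
  refine (norm_add₃_le).trans ?_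
  have h3 : ‖((A * L : ℝ) : ℂ)‖ ≤ A * B := by
    rw [Complex.norm_real, Real.norm_eq_abs, abs_mul, abs_of_pos hA0]
    gcongr
  have hB0 : 0 ≤ B := (abs_nonneg _).trans hlogB
  have h4 : 6 * ε' * (A * (L - Real.log s)) ≤ ε * (-Real.log s) + ε * B := by
    have h5 : L - Real.log s ≤ B + -Real.log s := by linarith [(abs_le.1 hlogB).2]
    calc 6 * ε' * (A * (L - Real.log s)) = (6 * ε' * A) * (L - Real.log s) := by ring
      _ ≤ (6 * ε' * A) * (B + -Real.log s) := by gcongr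
      _ ≤ ε * (B + -Real.log s) := by gcongr
      _ = _ := by ring
  linarith

/-- Logarithmic growth of the Abel sums of the Green function. -/
lemma tendsto_abel_div_log {ζ : ℕ → Ω → (Fin 2 → ℤ)} (hζ : IsPlanarWalkSteps P ζ)
    (p : Fin 2 → ℤ) :
    Tendsto (fun N : ℕ => (∑' k : ℕ, (1 - 1 / (N : ℝ)) ^ k * P.real {ω | incr ζ 0 k ω = p}) /
      Real.log N) atTop (𝓝 (walkConst P (ζ 0) / 2)) := by
  obtain ⟨a, b, c, ha, hd, hdet, hexp⟩ := exists_quadForm_expansion hζ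
  have hlog : Tendsto (fun n : ℕ => Real.log n) atTop atTop :=
    Real.tendsto_log_atTop.comp tendsto_natCast_atTop_atTop
  set G : ℕ → ℝ := fun N => ∑' k : ℕ, (1 - 1 / (N : ℝ)) ^ k * P.real {ω | incr ζ 0 k ω = p} with hG
  set A := 2 * Real.pi / Real.sqrt (a * c - b ^ 2) with hA
  have hpi := Real.pi_pos
  have hsd := Real.sqrt_pos.2 hd
  have hbound : ∀ ε > 0, ∃ K, ∀ N : ℕ, 1 < N →
      |(2 * Real.pi) ^ 2 * G N - A * Real.log N| ≤ ε * Real.log N + K := by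
    intro ε hε
    obtain ⟨K, hK⟩ := exists_green_integral_bound (φ := latticeCF P (ζ 0))
      (χ := fun t => latticeChar t (-p)) (continuous_latticeCF (hζ.measurable 0))
      (continuous_latticeChar _) (by simp [latticeChar, freqDot])
      (fun t => (norm_latticeChar _ _).le) (norm_latticeCF_le _)
      (fun t ht h => eq_zero_of_latticeCF_eq_one hζ ht h) ha hd hexp hε
    refine ⟨K, fun N hN => ?_⟩
    have hN' : (1 : ℝ) < N := by exact_mod_cast hN
    have hs0 : 0 < 1 / (N : ℝ) := by positivity
    have hs1 : 1 / (N : ℝ) < 1 := by rw [div_lt_one (by linarith)]; exact hN'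
    have h1 := hK _ hs0 hs1
    have h2 := (hasSum_abel hζ p (r := 1 - 1 / (N : ℝ)) (by linarith) (by linarith)).tsum_eq
    rw [tsum_mul_left, ← Complex.ofReal_tsum] at h2
    rw [← h2] at h1
    have h3 : (2 * (Real.pi : ℂ)) ^ 2 * ((G N : ℝ) : ℂ) - ((A * (-Real.log (1 / (N : ℝ))) : ℝ) : ℂ) =
        (((2 * Real.pi) ^ 2 * G N - A * Real.log N : ℝ) : ℂ) := by
      rw [one_div, Real.log_inv, neg_neg]; push_cast; ring
    rw [h3, Complex.norm_real, Real.norm_eq_abs, one_div, Real.log_inv, neg_neg] at h1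
    exact h1
  have hlo : (fun N : ℕ => (2 * Real.pi) ^ 2 * G N - A * Real.log N) =o[atTop]
      (fun N : ℕ => Real.log N) := by
    refine isLittleO_iff.2 fun ε hε => ?_
    obtain ⟨K, hK⟩ := hbound (ε / 2) (by positivity)
    filter_upwards [eventually_gt_atTop 1, hlog.eventually_ge_atTop (K / (ε / 2)),
      hlog.eventually_gt_atTop 0] with N hN h1 h2
    rw [div_le_iff₀ (by positivity)] at h1
    rw [Real.norm_eq_abs, Real.norm_of_nonneg h2.le]
    linarith [hK N hN]
  have h1 := (hlo.tendsto_div_nhds_zero.add_const A).div_const ((2 * Real.pi) ^ 2)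
  -- The value is `1/(2π√det)`. It is half the target because the Abel sums see one order of the two
  -- times only.
  have e : (0 + A) / (2 * Real.pi) ^ 2 = walkConst P (ζ 0) / 2 := by
    rw [walkConst, hdet, hA]
    field_simp
    ring
  rw [e] at h1
  refine h1.congr' ?_
  filter_upwards [hlog.eventually_gt_atTop 0] with N hN
  field_simp
  ring

end Green

/-! ### From Abel sums to double sums over a square. -/

section Summation

lemma sum_partialSums_eq (α : ℕ → ℝ) (N : ℕ) :
    ∑ M ∈ Finset.range N, ∑ k ∈ Finset.range (M + 1), α k =
      N * ∑ k ∈ Finset.range N, α k - ∑ k ∈ Finset.range N, k * α k := by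
  induction N with
  | zero => simp
  | succ N ih =>
    rw [Finset.sum_range_succ, ih, Finset.sum_range_succ, Finset.sum_range_succ]
    push_cast
    ring

/-- Summed partial sums of a sequence with terms `O(1/k)` agree with its Abel sums up to `O(1)`. -/
lemma abs_sum_partialSums_sub_abel_le {α : ℕ → ℝ} {K : ℝ} (h0 : ∀ k, 0 ≤ α k)
    (hK : ∀ k : ℕ, α k ≤ K / (k + 1)) {N : ℕ} (hN : 0 < N) :
    |∑ M ∈ Finset.range N, ∑ k ∈ Finset.range (M + 1), α k -
      N * ∑' k : ℕ, (1 - 1 / (N : ℝ)) ^ k * α k| ≤ 3 * K * N := by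
  have hN' : (1 : ℝ) ≤ N := by exact_mod_cast hN
  have hNpos : (0 : ℝ) < N := by linarith
  have hK0 : 0 ≤ K := by simpa using (h0 0).trans (hK 0)
  set r : ℝ := 1 - 1 / (N : ℝ) with hr
  have hinv : 1 / (N : ℝ) ≤ 1 := by rw [div_le_one hNpos]; exact hN'
  have hr0 : 0 ≤ r := by linarith
  have hr1 : r < 1 := by
    have : 0 < 1 / (N : ℝ) := by positivity
    linarith
  have hkα : ∀ k : ℕ, k * α k ≤ K := fun k => by
    have h1 := hK k
    rw [le_div_iff₀ (by positivity)] at h1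
    nlinarith [h0 k]
  have hαK : ∀ k, α k ≤ K := fun k => (hK k).trans (div_le_self hK0 (by linarith [(Nat.cast_nonneg k : (0 : ℝ) ≤ k)]))
  have hsum : Summable fun k : ℕ => r ^ k * α k :=
    Summable.of_nonneg_of_le (fun k => mul_nonneg (pow_nonneg hr0 k) (h0 k))
      (fun k => mul_le_mul_of_nonneg_left (hαK k) (pow_nonneg hr0 k))
      ((summable_geometric_of_lt_one hr0 hr1).mul_right K)
  have hsplit := hsum.sum_add_tsum_nat_add N
  set T := ∑' k : ℕ, r ^ (k + N) * α (k + N) with hT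
  have hT0 : 0 ≤ T := tsum_nonneg fun k => mul_nonneg (pow_nonneg hr0 _) (h0 _)
  -- Beyond `N` the terms are at most `K/N`, and the geometric series with ratio `1 - 1/N` sums to
  -- `N`.
  have hTK : T ≤ K := by
    have hgeo := (hasSum_geometric_of_lt_one hr0 hr1).mul_right (K / N)
    have e : (1 - r)⁻¹ * (K / N) = K := by rw [hr]; field_simp; ring
    rw [e] at hgeo
    refine (Summable.tsum_le_tsum (fun k => ?_) ((summable_nat_add_iff N).2 hsum)
      hgeo.summable).trans hgeo.tsum_eq.le
    have h1 : r ^ (k + N) ≤ r ^ k := pow_le_pow_of_le_one hr0 hr1.le (by omega)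
    have h2 : α (k + N) ≤ K / N := by
      refine (hK _).trans (div_le_div_of_nonneg_left hK0 hNpos ?_)
      push_cast
      linarith [(Nat.cast_nonneg k : (0 : ℝ) ≤ k)]
    exact mul_le_mul h1 h2 (h0 _) (pow_nonneg hr0 _)
  have hlow : ∑ k ∈ Finset.range N, r ^ k * α k ≤ ∑ k ∈ Finset.range N, α k :=
    Finset.sum_le_sum fun k _ => mul_le_of_le_one_left (h0 k) (pow_le_one₀ hr0 hr1.le)
  -- Bernoulli's inequality `r^k ≥ 1 - k/N` loses at most `k α_k / N ≤ K/N` per term.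
  have hup : ∑ k ∈ Finset.range N, α k - K ≤ ∑ k ∈ Finset.range N, r ^ k * α k := by
    have h1 : ∀ k ∈ Finset.range N, α k - K / N ≤ r ^ k * α k := by
      intro k _
      have hb := one_add_mul_le_pow (a := -(1 / (N : ℝ))) (by linarith) k
      rw [← sub_eq_add_neg, ← hr] at hb
      have h2 : (1 + k * -(1 / (N : ℝ))) * α k ≤ r ^ k * α k := by gcongr; exact h0 k
      have h3 : k * α k / N ≤ K / N := by gcongr; exact hkα k
      have e : (1 + k * -(1 / (N : ℝ))) * α k = α k - k * α k / N := by ring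
      linarith
    have h2 := Finset.sum_le_sum h1
    rw [Finset.sum_sub_distrib] at h2
    simp only [Finset.sum_const, Finset.card_range, nsmul_eq_mul] at h2
    rwa [mul_div_cancel₀ _ hNpos.ne'] at h2
  have hweight0 : 0 ≤ ∑ k ∈ Finset.range N, k * α k :=
    Finset.sum_nonneg fun k _ => mul_nonneg (Nat.cast_nonneg k) (h0 k)
  have hweight : ∑ k ∈ Finset.range N, k * α k ≤ N * K := by
    refine (Finset.sum_le_sum fun k _ => hkα k).trans (le_of_eq ?_)
    simp
  rw [sum_partialSums_eq, ← hsplit, abs_le]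
  constructor <;> nlinarith

/-- Each closed triangle is a sum of partial sums. The diagonal belongs to `α`, so its copy in the
second triangle is subtracted. -/
lemma sum_square_eq (α α' : ℕ → ℝ) (N : ℕ) :
    ∑ i ∈ Finset.range N, ∑ j ∈ Finset.range N, (if j ≤ i then α (i - j) else α' (j - i)) =
      ∑ M ∈ Finset.range N, ∑ k ∈ Finset.range (M + 1), α k +
        ∑ M ∈ Finset.range N, ∑ k ∈ Finset.range (M + 1), α' k - N * α' 0 := by
  induction N with
  | zero => simp
  | succ N ih =>
    have hrefl : ∀ β : ℕ → ℝ, ∑ k ∈ Finset.range (N + 1), β k =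
        ∑ j ∈ Finset.range N, β (N - j) + β 0 := by
      intro β
      rw [← Finset.sum_range_reflect, Finset.sum_range_succ]
      simp
    have h1 : ∑ i ∈ Finset.range N, (if N ≤ i then α (i - N) else α' (N - i)) =
        ∑ i ∈ Finset.range N, α' (N - i) :=
      Finset.sum_congr rfl fun i hi => if_neg (not_le.2 (Finset.mem_range.1 hi))
    have h2 : ∑ j ∈ Finset.range N, (if j ≤ N then α (N - j) else α' (j - N)) =
        ∑ j ∈ Finset.range N, α (N - j) :=
      Finset.sum_congr rfl fun j hj => if_pos (Finset.mem_range.1 hj).le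
    rw [Finset.sum_range_succ]
    simp only [Finset.sum_range_succ _ N] at *
    rw [Finset.sum_add_distrib, ih, h1, h2]
    have e1 := hrefl α
    have e2 := hrefl α'
    simp only [le_refl, if_true, Nat.sub_self]
    push_cast
    linarith

end Summation

/-! ### Mean of the self-counts, and the almost sure dyadic law. -/

section Mean

variable {Ω : Type*} [MeasurableSpace Ω] {P : Measure Ω} [IsProbabilityMeasure P]

/-- Stationarity of increments, read off Fourier inversion: both characteristic functions are the
same power of that of one step. -/
lemma measureReal_incr_eq {ζ : ℕ → Ω → (Fin 2 → ℤ)} (hζ : IsPlanarWalkSteps P ζ) {u v : ℕ}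
    (h : u ≤ v) (p : Fin 2 → ℤ) :
    P.real {ω | incr ζ u v ω = p} = P.real {ω | incr ζ 0 (v - u) ω = p} := by
  have h1 := integral_latticeCF_mul (P := P) (measurable_incr hζ.measurable h) p
  have h2 := integral_latticeCF_mul (P := P)
    (measurable_incr hζ.measurable (Nat.zero_le (v - u))) p
  simp only [latticeCF_incr hζ.measurable hζ.indep hζ.identDistrib h] at h1
  simp only [latticeCF_incr hζ.measurable hζ.indep hζ.identDistrib (Nat.zero_le (v - u)),
    Nat.sub_zero] at h2
  have hpi : (2 * (Real.pi : ℂ)) ^ 2 ≠ 0 := by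
    have : (Real.pi : ℂ) ≠ 0 := by exact_mod_cast Real.pi_ne_zero
    exact pow_ne_zero 2 (mul_ne_zero two_ne_zero this)
  exact_mod_cast mul_left_cancel₀ hpi (h1.symm.trans h2)

lemma integral_selfCount {ζ : ℕ → Ω → (Fin 2 → ℤ)} (hζ : IsPlanarWalkSteps P ζ) (l N : ℕ)
    (p : Fin 2 → ℤ) :
    ∫ ω, (selfCount (fun i => ζ i ω) (Finset.Ioc l (l + N)) p : ℝ) ∂P =
      ∑ i ∈ Finset.range N, ∑ j ∈ Finset.range N,
        (if j ≤ i then P.real {ω | incr ζ 0 (i - j) ω = p}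
          else P.real {ω | incr ζ 0 (j - i) ω = -p}) := by
  have hR : ∀ f : ℕ → ℝ, ∑ v ∈ Finset.Ioc l (l + N), f v =
      ∑ j ∈ Finset.range N, f (l + 1 + j) := by
    intro f
    refine Finset.sum_nbij' (fun u => u - (l + 1)) (fun j => l + 1 + j) ?_ ?_ ?_ ?_ ?_ <;>
      intro u hu <;> simp only [Finset.mem_Ioc, Finset.mem_range] at hu ⊢ <;> try omega
    rw [Nat.add_sub_cancel' (by omega)]
  have hw : ∀ n, Measurable fun ω => walk (fun i => ζ i ω) n := fun n =>
    Finset.measurable_sum _ fun i _ => hζ.measurable i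
  have hset : ∀ u v, MeasurableSet {ω | walk (fun i => ζ i ω) u - walk (fun i => ζ i ω) v = p} :=
    fun u v => ((hw u).sub (hw v)) (measurableSet_singleton p)
  have e : ∀ ω, (selfCount (fun i => ζ i ω) (Finset.Ioc l (l + N)) p : ℝ) =
      ∑ i ∈ Finset.range N, ∑ j ∈ Finset.range N,
        {ω | walk (fun i => ζ i ω) (l + 1 + i) - walk (fun i => ζ i ω) (l + 1 + j) = p}.indicator
          (1 : Ω → ℝ) ω := by
    intro ω
    rw [selfCount, crossCount_eq_sum]
    push_cast
    rw [hR]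
    refine Finset.sum_congr rfl fun i _ => ?_
    rw [hR]
    refine Finset.sum_congr rfl fun j _ => ?_
    simp only [Set.indicator_apply, Set.mem_ofPred_eq, Pi.one_apply]
  have hint : ∀ u v, Integrable ({ω | walk (fun i => ζ i ω) u - walk (fun i => ζ i ω) v = p}.indicator
      (1 : Ω → ℝ)) P := fun u v => (integrable_const (1 : ℝ)).indicator (hset u v)
  simp only [e]
  rw [integral_finsetSum _ fun i _ => integrable_finsetSum _ fun j _ => hint _ _]
  refine Finset.sum_congr rfl fun i _ => ?_
  rw [integral_finsetSum _ fun j _ => hint _ _]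
  refine Finset.sum_congr rfl fun j _ => ?_
  rw [integral_indicator_one (hset _ _)]
  split_ifs with hij
  · have := measureReal_incr_eq hζ (show l + 1 + j ≤ l + 1 + i by omega) p
    rwa [show l + 1 + i - (l + 1 + j) = i - j by omega] at this
  · have := measureReal_incr_eq hζ (show l + 1 + i ≤ l + 1 + j by omega) (-p)
    rw [show l + 1 + j - (l + 1 + i) = j - i by omega] at this
    rw [← this]
    congr 1
    ext ω
    simp only [Set.mem_ofPred_eq, incr]
    rw [← neg_sub, neg_eq_iff_eq_neg]

/-- The two orders of the times contribute `C₀/2` each, through the targets `p` and `-p`, as the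
Abel asymptotic does not depend on the target; the diagonal correction is `O(N)`. -/
lemma tendsto_integral_selfCount {ζ : ℕ → Ω → (Fin 2 → ℤ)} (hζ : IsPlanarWalkSteps P ζ)
    (p : Fin 2 → ℤ) :
    Tendsto (fun N : ℕ => (∑ i ∈ Finset.range N, ∑ j ∈ Finset.range N,
        (if j ≤ i then P.real {ω | incr ζ 0 (i - j) ω = p}
          else P.real {ω | incr ζ 0 (j - i) ω = -p})) / (N * Real.log N)) atTop
      (𝓝 (walkConst P (ζ 0))) := by
  obtain ⟨K, hK⟩ := exists_atom_bound hζ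
  have hlog : Tendsto (fun n : ℕ => Real.log n) atTop atTop :=
    Real.tendsto_log_atTop.comp tendsto_natCast_atTop_atTop
  have hcesaro : ∀ y : Fin 2 → ℤ, Tendsto (fun N : ℕ => (∑ M ∈ Finset.range N,
      ∑ k ∈ Finset.range (M + 1), P.real {ω | incr ζ 0 k ω = y}) / (N * Real.log N)) atTop
      (𝓝 (walkConst P (ζ 0) / 2)) := by
    intro y
    have h1 := tendsto_abel_div_log hζ y
    have h2 : Tendsto (fun N : ℕ => (∑ M ∈ Finset.range N,
        ∑ k ∈ Finset.range (M + 1), P.real {ω | incr ζ 0 k ω = y}) / (N * Real.log N) -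
        (∑' k : ℕ, (1 - 1 / (N : ℝ)) ^ k * P.real {ω | incr ζ 0 k ω = y}) / Real.log N) atTop
        (𝓝 0) := by
      refine squeeze_zero_norm' ?_ (hlog.const_div_atTop (3 * K))
      filter_upwards [eventually_gt_atTop 0, hlog.eventually_gt_atTop 0] with N hN hl
      have hN' : (0 : ℝ) < N := by exact_mod_cast hN
      have h3 := abs_sum_partialSums_sub_abel_le
        (α := fun k => P.real {ω | incr ζ 0 k ω = y}) (fun k => measureReal_nonneg)
        (fun k => by simpa using hK 0 k y (Nat.zero_le k)) hN
      set S := ∑ M ∈ Finset.range N, ∑ k ∈ Finset.range (M + 1), P.real {ω | incr ζ 0 k ω = y}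
      set G := ∑' k : ℕ, (1 - 1 / (N : ℝ)) ^ k * P.real {ω | incr ζ 0 k ω = y}
      have e : S / (N * Real.log N) - G / Real.log N = (S - N * G) / (N * Real.log N) := by
        field_simp
      rw [e, Real.norm_eq_abs, abs_div, abs_of_pos (mul_pos hN' hl), div_le_div_iff₀
        (mul_pos hN' hl) hl]
      calc |S - N * G| * Real.log N ≤ 3 * K * N * Real.log N := by gcongr
        _ = _ := by ring
    have h3 := h2.add h1
    rw [zero_add] at h3
    exact h3.congr fun N => sub_add_cancel _ _
  have hdiag : Tendsto (fun N : ℕ => P.real {ω | incr ζ 0 0 ω = -p} / Real.log N) atTop (𝓝 0) :=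
    hlog.const_div_atTop _
  have h := ((hcesaro p).add (hcesaro (-p))).sub hdiag
  have e : walkConst P (ζ 0) / 2 + walkConst P (ζ 0) / 2 - 0 = walkConst P (ζ 0) := by ring
  rw [e] at h
  refine h.congr' ?_
  filter_upwards [eventually_gt_atTop 0, hlog.eventually_gt_atTop 0] with N hN hl
  have hN' : (0 : ℝ) < N := by exact_mod_cast hN
  rw [sum_square_eq (fun k => P.real {ω | incr ζ 0 k ω = p})
    (fun k => P.real {ω | incr ζ 0 k ω = -p})]
  field_simp

/-- Almost surely, the self-intersection counts have the right growth along dyadic intervals. -/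
lemma ae_tendsto_dyadic_selfCount {ζ : ℕ → Ω → (Fin 2 → ℤ)} (hζ : IsPlanarWalkSteps P ζ) :
    ∀ᵐ ω ∂P, ∀ (p : Fin 2 → ℤ) (i j : ℕ), i ≤ j → Tendsto (fun k : ℕ =>
      (selfCount (fun i => ζ i ω) (Finset.Ioc (i * 2 ^ k) (j * 2 ^ k)) p : ℝ) / (2 ^ k * k)) atTop
        (𝓝 (walkConst P (ζ 0) * (j - i) * Real.log 2)) := by
  obtain ⟨K, hK⟩ := exists_atom_bound hζ
  have hall : ∀ᵐ ω ∂P, ∀ (p : Fin 2 → ℤ) (i q : ℕ), Tendsto (fun k : ℕ =>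
      ((selfCount (fun j => ζ j ω) (Finset.Ioc (i * 2 ^ k) (i * 2 ^ k + q * 2 ^ k)) p : ℝ) -
        ∫ ω', (selfCount (fun j => ζ j ω') (Finset.Ioc (i * 2 ^ k) (i * 2 ^ k + q * 2 ^ k)) p : ℝ)
          ∂P) / (2 ^ k * k)) atTop (𝓝 0) :=
    ae_all_iff.2 fun p => ae_all_iff.2 fun i => ae_all_iff.2 fun q =>
      ae_tendsto_centered_selfCount hζ.measurable hζ.indep hK i q p
  filter_upwards [hall] with ω hω p i j hij
  obtain ⟨q, rfl⟩ := Nat.exists_eq_add_of_le hij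
  have hcast : ((i + q : ℕ) : ℝ) - i = q := by push_cast; ring
  rw [hcast]
  rcases Nat.eq_zero_or_pos q with rfl | hq
  · simp [selfCount, crossCount]
  have hq' : (0 : ℝ) < q := by exact_mod_cast hq
  have hNtop : Tendsto (fun k : ℕ => q * 2 ^ k) atTop atTop :=
    tendsto_atTop_mono (fun k => Nat.le_mul_of_pos_left _ hq)
      (tendsto_pow_atTop_atTop_of_one_lt one_lt_two)
  have h1 := (tendsto_integral_selfCount hζ p).comp hNtop
  -- This is `N log N / (2^k k)` for `N = q 2^k`.
  have h2 : Tendsto (fun k : ℕ => q * (Real.log q / k + Real.log 2)) atTop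
      (𝓝 (q * (0 + Real.log 2))) :=
    ((tendsto_const_div_atTop_nhds_zero_nat _).add_const _).const_mul _
  have h3 := (hω p i q).add (h1.mul h2)
  have e : 0 + walkConst P (ζ 0) * (q * (0 + Real.log 2)) =
      walkConst P (ζ 0) * q * Real.log 2 := by ring
  rw [e] at h3
  refine h3.congr' ?_
  have hlogN : Tendsto (fun k : ℕ => Real.log ((q * 2 ^ k : ℕ) : ℝ)) atTop atTop :=
    (Real.tendsto_log_atTop.comp tendsto_natCast_atTop_atTop).comp hNtop
  filter_upwards [eventually_gt_atTop 0, hlogN.eventually_gt_atTop 0] with k hk hl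
  have hk' : (0 : ℝ) < k := by exact_mod_cast hk
  have hlogeq : Real.log ((q * 2 ^ k : ℕ) : ℝ) = Real.log q + k * Real.log 2 := by
    push_cast
    rw [Real.log_mul hq'.ne' (by positivity), Real.log_pow]
  rw [integral_selfCount hζ, add_mul i q]
  simp only [Function.comp_def]
  rw [hlogeq] at hl ⊢
  push_cast
  have e2 : (q : ℝ) * (Real.log q / k + Real.log 2) = q * (Real.log q + k * Real.log 2) / k := by
    field_simp
  rw [e2]
  field_simp
  ring

lemma walkConst_pos {ζ : ℕ → Ω → (Fin 2 → ℤ)} (hζ : IsPlanarWalkSteps P ζ) :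
    0 < walkConst P (ζ 0) := by
  obtain ⟨a, b, c, -, hd, hdet, -⟩ := exists_quadForm_expansion hζ
  rw [walkConst, hdet]
  have := Real.sqrt_pos.2 hd
  have := Real.pi_pos
  positivity

end Mean

theorem lemma1p4 {Ω : Type*} [MeasurableSpace Ω] (P : Measure Ω) [IsProbabilityMeasure P]
    (ζ : ℕ → Ω → (Fin 2 → ℤ)) (hζ : IsPlanarWalkSteps P ζ) :
    ∀ᵐ ω ∂P, ∀ p : Fin 2 → ℤ, ∀ A : ℝ, 0 < A → A < 1 →
      ∀ a a' b : ℕ → ℕ, IsRounding A a → IsRounding A a' → IsRounding (1 - A) b →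
        Tendsto (fun n : ℕ =>
            normalizedCount (walkConst P (ζ 0)) (shift (a n) (fun i => ζ i ω)) (b n) p)
          atTop (𝓝 1) ∧
        Tendsto (fun n : ℕ =>
            (selfCount (fun i => ζ i ω) (Finset.Icc (a n) n) p : ℝ) /
              (walkConst P (ζ 0) * (n * (1 - A)) * Real.log n))
          atTop (𝓝 1) ∧
        (fun n : ℕ =>
            (crossCount (fun i => ζ i ω) (Finset.Icc 1 (a n)) (Finset.Icc (a' n) n) p : ℝ) +
              (crossCount (fun i => ζ i ω) (Finset.Icc (a' n) n) (Finset.Icc 1 (a n)) p : ℝ))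
          =o[atTop] (fun n : ℕ => (n : ℝ) * Real.log n) := by
  filter_upwards [ae_tendsto_dyadic_selfCount hζ] with ω hω p A hA0 hA1 a a' b ha ha' hb
  exact counts_of_dyadic _ (walkConst_pos hζ) p (hω p) hA0 hA1 ha ha' hb
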